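/- Index the three nodes cyclically by $\{1,2,3\}$. Let $\lambda_i,\mu_i>0$ with $\lambda_i/\mu_i<1$ for each $i$ and $\sum_i\lambda_i/\mu_i>1$, and let $d_1,d_2,d_3\in(0,1)$. **Triangle process.** Let $A_i=\{z\in\mathbb R_+^3:\ z_1+z_2+z_3=1,\ z_i=0\}$, $A^0=A_1\cup A_2\cup A_3$, and $$f_j(z)=\sum_{i\ne j}\frac{(\mu_j-\lambda_j)z_i+\lambda_i z_j}{(\mu_j-\lambda_j)+(\sum_k\lambda_k-\mu_j)z_j}\,e_i .$$ Threshold rule: from $y\in\mathbb R_+^3\setminus\{0\}$ with $y_i=0$ and the server at node $i$, the server moves to $i+1$ if $y_{i+2}\le d_i(y_{i+1}+y_{i+2})$ and to $i+2$ if $y_{i+2}\ge d_i(y_{i+1}+y_{i+2})$; in case of equality either move is allowed. A trajectory of the triangle process $Z$ is a sequence $z(0),z(1),\dots$ in $A^0$ with $z(t+1)=f_j(z(t))$, where $j$ is a node allowed by the rule at $z(t)$. A periodic orbit is a finite sequence $u_1,\dots,u_m$ in which each point is followed in this way by the next one, and $u_m$ by $u_1$ (cyclic shifts and repetitions are identified).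 A sequence $z(t)$ in $A^0$ converges onto the orbit if for some $n_0$, $z(mt+n+n_0)\to u_n$ as $t\to\infty$ for $n=1,\dots,m$. The decision points are the points $(1-d_i)e_{i+1}+d_ie_{i+2}\in A_i$. Call $Z$ stable if it has finitely many periodic orbits and each of its trajectories converges onto one of them. **Polling system.** Jobs arrive at node $i$ in independent Poisson streams of rate $\lambda_i$; service times are independent of each other and of the arrivals, those at node $i$ being identically distributed with mean $1/\mu_i$ and finite variance. A single server serves its current node until it is empty and then, if the system is not empty, switches instantaneously to a node chosen by the threshold rule applied to the vector of queue lengths (ties are resolved in any nonanticipating, possibly randomized, way); if the system is empty the server waits for the next arrival. The initial state is arbitrary. Let $\xi(t)$ be the queue lengths at the successive epochs of the embedded process (service completions, switches, and arrivals that end an idle period), let $\tau_0<\tau_1<\cdots$ be the epochs at which the server changes queues, and let $\zeta(n)=\Lambda(\xi(\tau_n))$ with $\Lambda(y)=y/\sum_i y_i$. **Theorem 3.4.** Suppose that $Z$ is stable and that no periodic orbit of $Z$ contains a decision point. Then almost surely all the $\tau_n$ are finite, $\zeta$ converges onto one of the periodic orbits of $Z$, and the sequence of nodes that the server visits is eventually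 periodic. -/

import Mathlib

open MeasureTheory Filter
open scoped Topology

noncomputable section

namespace Polling

/-! ### The deterministic triangle process

Nodes are indexed by `Fin 3`, whose addition is cyclic: for a node `i` the other two nodes, in
cyclic order, are `i + 1` and `i + 2`. -/

/-- The side `A_i` of the unit simplex: nonnegative vectors of total mass `1` whose `i`-th
coordinate vanishes. -/
def side (i : Fin 3) : Set (Fin 3 → ℝ) :=
  {z | (∀ k, 0 ≤ z k) ∧ ∑ k, z k = 1 ∧ z i = 0}

/-- The triangle `A⁰`, that is, the boundary of the unit simplex. -/
def triangle : Set (Fin 3 → ℝ) := ⋃ i, side i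

/-- The projection `Λ(y) = y / ∑ y_i`. -/
def proj (y : Fin 3 → ℝ) : Fin 3 → ℝ := fun i => y i / ∑ k, y k

/-- The decision point on side `i`: the point `(1 - d_i) e_{i+1} + d_i e_{i+2}`. -/
def decisionPoint (d : Fin 3 → ℝ) (i : Fin 3) : Fin 3 → ℝ :=
  fun k => if k = i + 1 then 1 - d i else if k = i + 2 then d i else 0

/-- The threshold rule. `Selects d i y j` says that the server, having emptied node `i` and seeing
the contents `y` (with `y i = 0`), may move to node `j`. It goes to `i + 1` if the fraction
`y (i+2) / (y (i+1) + y (i+2))` is at most `d i`, and to `i + 2` if it is at least `d i`; if it is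
equal to `d i` both moves are allowed. With weights `b_{i,i+1}, b_{i,i+2} > 0` and
`d i = (1 + b_{i,i+2} / b_{i,i+1})⁻¹` this is the generalized greedy rule which moves to a node
`j` that maximizes `b_{i,j} y_j`. -/
def Selects (d : Fin 3 → ℝ) (i : Fin 3) (y : Fin 3 → ℝ) (j : Fin 3) : Prop :=
  (j = i + 1 ∧ y (i + 2) ≤ d i * (y (i + 1) + y (i + 2))) ∨
  (j = i + 2 ∧ d i * (y (i + 1) + y (i + 2)) ≤ y (i + 2))

/-- The map `f_j`: the projection of the point where the fluid trajectory
from `z` with the server at `j` empties node `j`. The denominator is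
`(μ_j - λ_j) + μ_j θ_j z_j` with `μ_j θ_j = ∑ λ_k - μ_j`. -/
def nodeMap (lam mu : Fin 3 → ℝ) (j : Fin 3) (z : Fin 3 → ℝ) : Fin 3 → ℝ :=
  fun i => if i = j then 0 else
    ((mu j - lam j) * z i + lam i * z j) / ((mu j - lam j) + ((∑ k, lam k) - mu j) * z j)

/-- One step `z' = φ(z)` of the triangle process. It is single valued except at the decision
points, which have two images. -/
def Step (lam mu d : Fin 3 → ℝ) (z z' : Fin 3 → ℝ) : Prop :=
  ∃ i j, z ∈ side i ∧ Selects d i z j ∧ z' = nodeMap lam mu j z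

/-- A trajectory `z(0), z(1), …` of the triangle process (any choice may be made each time that
a decision point is hit). -/
def IsTrajectory (lam mu d : Fin 3 → ℝ) (z : ℕ → Fin 3 → ℝ) : Prop :=
  z 0 ∈ triangle ∧ ∀ t, Step lam mu d (z t) (z (t + 1))

/-- `u 0, …, u (m - 1)` is a periodic orbit; the finite sequence is continued `m`-periodically
to all indices. -/
def IsPeriodicOrbit (lam mu d : Fin 3 → ℝ) (m : ℕ) (u : ℕ → Fin 3 → ℝ) : Prop :=
  0 < m ∧ (∀ n, u (n + m) = u n) ∧ ∀ n, Step lam mu d (u n) (u (n + 1))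

/-- The collection of all periodic orbits, each taken as a set of points (so that sequences which
differ by a cyclic permutation give the same orbit). -/
def periodicOrbits (lam mu d : Fin 3 → ℝ) : Set (Set (Fin 3 → ℝ)) :=
  {O | ∃ m u, IsPeriodicOrbit lam mu d m u ∧ O = Set.range u}

/-- The sequence `z` converges onto `u 0, …, u (m - 1)`: for each phase `n`, the corresponding
subsequence of `z` converges to `u n`. -/
def ConvergesOnto (z : ℕ → Fin 3 → ℝ) (m : ℕ) (u : ℕ → Fin 3 → ℝ) : Prop :=
  ∃ n₀ : ℕ, ∀ n < m, Tendsto (fun t : ℕ => z (m * t + n + n₀)) atTop (𝓝 (u n))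

/-- The triangle process is stable: it has finitely many periodic orbits and each of its
trajectories converges onto one of them. -/
def IsStable (lam mu d : Fin 3 → ℝ) : Prop :=
  (periodicOrbits lam mu d).Finite ∧
  ∀ z, IsTrajectory lam mu d z →
    ∃ m u, IsPeriodicOrbit lam mu d m u ∧ ConvergesOnto z m u

/-- No periodic orbit passes through a decision point. -/
def OrbitsAvoidDecisionPoints (lam mu d : Fin 3 → ℝ) : Prop :=
  ∀ O ∈ periodicOrbits lam mu d, ∀ i, decisionPoint d i ∉ O

/-! ### The stochastic polling system -/

/-- The probability that exactly `n i` jobs arrive at node `i`, `i = 0, 1, 2`, during a service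
time with law `S`, the arrivals being independent Poisson streams with rates `lam i` that are
independent of the service time. -/
def arrivalProb (lam : Fin 3 → ℝ) (S : Measure ℝ) (n : Fin 3 → ℕ) : ℝ :=
  ∫ s, ∏ i, Real.exp (-(lam i * s)) * (lam i * s) ^ n i / (n i).factorial ∂S

/-- On the event `E` of the sigma-algebra `𝓕`, the conditional probability of `B` given `𝓕` is
the constant `p`. -/
def HasCondProb {Ω : Type*} [MeasurableSpace Ω] (P : Measure Ω) (𝓕 : MeasurableSpace Ω)
    (E B : Set Ω) (p : ℝ) : Prop :=
  ∀ A, MeasurableSet[𝓕] A → A ⊆ E → P (A ∩ B) = ENNReal.ofReal p * P A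

/-- `(ξ t, s t)`, the queue lengths and the location of the server, is the exhaustive polling
system with zero switching times, observed at service completions, at switches and at the
arrivals that end an idle period, with arrival rates `lam`, service time laws `S` and decision
points `d`. It starts from an arbitrary (random) state. The filtration may contain additional
randomness, and ties in the switching rule may be resolved in any (possibly random, history
dependent) nonanticipating way. -/
structure IsPollingProcess {Ω : Type*} [mΩ : MeasurableSpace Ω] (P : Measure Ω)
    (ℱ : Filtration ℕ mΩ) (lam : Fin 3 → ℝ) (S : Fin 3 → Measure ℝ) (d : Fin 3 → ℝ)
    (ξ : ℕ → Ω → Fin 3 → ℕ) (s : ℕ → Ω → Fin 3) : Prop where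
  adapted_queue : ∀ t, Measurable[ℱ t] (ξ t)
  adapted_server : ∀ t, Measurable[ℱ t] (s t)
  /-- If the server is at a nonempty node `j`, one job of node `j` is served and leaves, while
  `n i` new jobs arrive at each node `i` with probability `arrivalProb lam (S j) n`. -/
  service : ∀ t j n,
    HasCondProb P (ℱ t) {ω | s t ω = j ∧ 0 < ξ t ω j}
      {ω | s (t + 1) ω = j ∧ ∀ i, ξ (t + 1) ω i + (if i = j then 1 else 0) = ξ t ω i + n i}
      (arrivalProb lam (S j) n)
  /-- If the node of the server is empty and the system is not, the server switches at once to a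
  node that the threshold rule selects. -/
  switch : ∀ t, ∀ᵐ ω ∂P, ξ t ω (s t ω) = 0 → ξ t ω ≠ 0 →
    ξ (t + 1) ω = ξ t ω ∧ Selects d (s t ω) (fun i => (ξ t ω i : ℝ)) (s (t + 1) ω)
  /-- If the system is empty, the server waits where it is for the next arrival, which is at node
  `k` with probability `lam k / ∑ lam i`. -/
  idle : ∀ t j k,
    HasCondProb P (ℱ t) {ω | s t ω = j ∧ ξ t ω = 0}
      {ω | s (t + 1) ω = j ∧ ξ (t + 1) ω = Pi.single k 1}
      (lam k / ∑ i, lam i)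

/-- The set of times at which the server changes queues, for one realization `s` of the
sequence of locations of the server. -/
def switchTimes (s : ℕ → Fin 3) : Set ℕ := {t | s (t + 1) ≠ s t}

/-- `τ_n`, the `n`-th time (counted from `0`) at which the server changes queues; it is meaningful
for all `n` when `switchTimes s` is infinite. -/
def switchTime (s : ℕ → Fin 3) (n : ℕ) : ℕ := Nat.nth (· ∈ switchTimes s) n

/-- The stochastic triangle process `ζ(n) = Λ(ξ(τ_n))` along one realization. -/
def zeta (ξ : ℕ → Fin 3 → ℕ) (s : ℕ → Fin 3) (n : ℕ) : Fin 3 → ℝ :=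
  proj (fun i => (ξ (switchTime s n) i : ℝ))

/-- The node to which the server moves at time `τ_n`, along one realization. -/
def visitedNode (s : ℕ → Fin 3) (n : ℕ) : Fin 3 := s (switchTime s n + 1)

/-- A sequence of nodes is eventually periodic. -/
def EventuallyPeriodic (v : ℕ → Fin 3) : Prop :=
  ∃ m > 0, ∃ N, ∀ n ≥ N, v (n + m) = v n

end Polling

end

namespace Polling

/-! ### The triangle process in logarithmic coordinates -/

variable {lam mu d : Fin 3 → ℝ}

/-! The deterministic core is a contraction. On side `i` use the coordinate `log (z (i+1) / z
(i+2))`. In it each `f_j` is, up to sign and a constant, `log r ↦ log (a + c r) - log r`, where `a =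
μ_j - λ_j > 0`, `r` is the ratio of `z j` to the other nonzero coordinate, and `c > 0` is the
arrival rate at that other node. The derivative is `-a / (a + c r)`, and the threshold rule only
selects `j` when `r` is bounded below, so all the maps contract by one factor `c < 1`
(`exists_logRatio_contract`). Two points that receive the same sequence of moves therefore approach
each other; only the choice of moves can be unstable.

An orbit that avoids the decision points has a neighbourhood in which its moves are forced. By the
contraction this neighbourhood also traps sequences that follow the process with small errors, and
if the errors vanish the distance to the orbit tends to zero. Such a sequence does enter the
neighbourhood of some orbit: since ties allow both moves, the step relation is closed, so the limits
of its shifts along an ultrafilter form a true trajectory, which converges onto an orbit by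
stability (`exists_convergesOnto_of_pseudoTrajectory`).

It remains to see that `ζ` is almost surely such a sequence. The centred arrivals per service are
martingale differences with bounded second moments, so their averages vanish
(`ae_tendsto_average_of_orthogonal`). From there on the argument is pathwise. As the load exceeds
one, the queues grow linearly (`exists_linear_growth`), so noise of order `o(t)` is negligible
against them, and between two switches the path follows the fluid up to a vanishing relative error
(`eventually_abs_sub_le`). Projecting to the triangle gives the required errors
(`IsDrivenPath.converges`). -/

lemma sum_cyclic {M : Type*} [AddCommMonoid M] (f : Fin 3 → M) (i : Fin 3) :
    ∑ k, f k = f i + f (i + 1) + f (i + 2) := by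
  fin_cases i <;> simp [Fin.sum_univ_three] <;> abel

lemma add_one_add_one (i : Fin 3) : i + 1 + 1 = i + 2 := by revert i; decide
lemma add_one_add_two (i : Fin 3) : i + 1 + 2 = i := by revert i; decide
lemma add_two_add_one (i : Fin 3) : i + 2 + 1 = i := by revert i; decide
lemma add_two_add_two (i : Fin 3) : i + 2 + 2 = i + 1 := by revert i; decide
lemma add_one_ne (i : Fin 3) : i + 1 ≠ i := by revert i; decide
lemma add_two_ne (i : Fin 3) : i + 2 ≠ i := by revert i; decide
lemma add_one_ne_add_two (i : Fin 3) : i + 1 ≠ i + 2 := by revert i; decide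

lemma eq_cyclic (i k : Fin 3) : k = i ∨ k = i + 1 ∨ k = i + 2 := by revert i k; decide

lemma exists_pos_le {ι : Type*} [Finite ι] (f : ι → ℝ) (hf : ∀ i, 0 < f i) :
    ∃ ε > 0, ∀ i, ε ≤ f i := by
  cases isEmpty_or_nonempty ι
  · exact ⟨1, one_pos, fun i => isEmptyElim i⟩
  · obtain ⟨i, hi⟩ := Finite.exists_min f
    exact ⟨f i, hf i, hi⟩

lemma sum_eq_one_of_mem_side {i : Fin 3} {z : Fin 3 → ℝ} (hz : z ∈ side i) :
    z (i + 1) + z (i + 2) = 1 := by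
  have h := hz.2.1
  rw [sum_cyclic z i, hz.2.2] at h
  linarith

lemma le_one_of_mem_side {i : Fin 3} {z : Fin 3 → ℝ} (hz : z ∈ side i) (k : Fin 3) : z k ≤ 1 := by
  rw [← hz.2.1]
  exact Finset.single_le_sum (fun k _ => hz.1 k) (Finset.mem_univ k)

lemma selects_iff_of_mem_side {i j : Fin 3} {z : Fin 3 → ℝ} (hz : z ∈ side i) :
    Selects d i z j ↔ (j = i + 1 ∧ z (i + 2) ≤ d i) ∨ (j = i + 2 ∧ d i ≤ z (i + 2)) := by
  simp [Selects, sum_eq_one_of_mem_side hz]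

lemma Selects.ne {i j : Fin 3} {z : Fin 3 → ℝ} (h : Selects d i z j) : j ≠ i := by
  rcases h with ⟨rfl, -⟩ | ⟨rfl, -⟩
  · exact add_one_ne i
  · exact add_two_ne i

lemma Selects.smul {i j : Fin 3} {y : Fin 3 → ℝ} (h : Selects d i y j) {c : ℝ} (hc : 0 ≤ c) :
    Selects d i (c • y) j := by
  rcases h with ⟨rfl, h⟩ | ⟨rfl, h⟩
  · refine Or.inl ⟨rfl, ?_⟩
    have := mul_le_mul_of_nonneg_left h hc
    simp only [Pi.smul_apply, smul_eq_mul]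
    linarith
  · refine Or.inr ⟨rfl, ?_⟩
    have := mul_le_mul_of_nonneg_left h hc
    simp only [Pi.smul_apply, smul_eq_mul]
    linarith

/-- The threshold rule only selects nodes whose share of the total mass is bounded below. -/
lemma exists_le_of_selects (hd : ∀ i, d i ∈ Set.Ioo (0 : ℝ) 1) :
    ∃ κ > 0, ∀ i j z, z ∈ side i → Selects d i z j → κ ≤ z j := by
  obtain ⟨κ, hκ, h⟩ := exists_pos_le (fun i => min (d i) (1 - d i))
    (fun i => lt_min (hd i).1 (sub_pos.2 (hd i).2))
  refine ⟨κ, hκ, fun i j z hz hs => ?_⟩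
  have h1 := sum_eq_one_of_mem_side hz
  have h2 := h i
  rcases (selects_iff_of_mem_side hz).1 hs with ⟨rfl, h3⟩ | ⟨rfl, h3⟩
  · have := h2.trans (min_le_right _ _)
    linarith
  · exact (h2.trans (min_le_left _ _)).trans h3

/-- This form is a convex combination of two positive numbers on the simplex, whatever the sign of
`∑ λ_k - μ_j`. -/
lemma nodeMap_den_eq {j : Fin 3} {z : Fin 3 → ℝ} :
    (mu j - lam j) + ((∑ k, lam k) - mu j) * z j =
      (mu j - lam j) * (1 - z j) + (lam (j + 1) + lam (j + 2)) * z j := by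
  rw [sum_cyclic lam j]
  ring

lemma nodeMap_den_pos (hlam : ∀ i, 0 < lam i) (hlm : ∀ i, lam i < mu i) {i j : Fin 3}
    {z : Fin 3 → ℝ} (hz : z ∈ side i) :
    0 < (mu j - lam j) + ((∑ k, lam k) - mu j) * z j := by
  rw [nodeMap_den_eq]
  have h1 := sub_pos.2 (hlm j)
  have h2 := add_pos (hlam (j + 1)) (hlam (j + 2))
  have h3 := hz.1 j
  have h4 := le_one_of_mem_side hz j
  rcases h3.eq_or_lt with h | h
  · rw [← h]; simpa using h1
  · have := mul_nonneg h1.le (sub_nonneg.2 h4)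
    have := mul_pos h2 h
    linarith

lemma nodeMap_self (j : Fin 3) (z : Fin 3 → ℝ) : nodeMap lam mu j z j = 0 := by simp [nodeMap]

lemma nodeMap_of_ne {j k : Fin 3} (h : k ≠ j) (z : Fin 3 → ℝ) :
    nodeMap lam mu j z k = ((mu j - lam j) * z k + lam k * z j) /
      ((mu j - lam j) + ((∑ k, lam k) - mu j) * z j) := by simp [nodeMap, h]

lemma nodeMap_mem_side (hlam : ∀ i, 0 < lam i) (hlm : ∀ i, lam i < mu i) {i j : Fin 3}
    {z : Fin 3 → ℝ} (hz : z ∈ side i) : nodeMap lam mu j z ∈ side j := by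
  have hD := nodeMap_den_pos hlam hlm (j := j) hz
  refine ⟨fun k => ?_, ?_, nodeMap_self j z⟩
  · by_cases h : k = j
    · rw [h, nodeMap_self]
    · rw [nodeMap_of_ne h]
      exact div_nonneg (add_nonneg (mul_nonneg (sub_pos.2 (hlm j)).le (hz.1 k))
        (mul_nonneg (hlam k).le (hz.1 j))) hD.le
  · rw [sum_cyclic _ j, nodeMap_self, nodeMap_of_ne (add_one_ne j), nodeMap_of_ne (add_two_ne j),
      zero_add, ← add_div, div_eq_one_iff_eq hD.ne', nodeMap_den_eq]
    have h := hz.2.1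
    rw [sum_cyclic z j] at h
    linear_combination (mu j - lam j) * h

lemma continuousOn_nodeMap (hlam : ∀ i, 0 < lam i) (hlm : ∀ i, lam i < mu i) (i j : Fin 3) :
    ContinuousOn (nodeMap lam mu j) (side i) := by
  refine continuousOn_pi.2 fun k => ?_
  by_cases h : k = j
  · simp only [h, nodeMap_self]
    exact continuousOn_const
  · simp only [nodeMap_of_ne h]
    exact ContinuousOn.div (by fun_prop) (by fun_prop)
      fun z hz => (nodeMap_den_pos hlam hlm hz).ne'

/-- After one step the triangle process stays away from the corners. -/
lemma exists_le_nodeMap (hlam : ∀ i, 0 < lam i) (hlm : ∀ i, lam i < mu i)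
    (hd : ∀ i, d i ∈ Set.Ioo (0 : ℝ) 1) :
    ∃ κ > 0, ∀ i j z, z ∈ side i → Selects d i z j → ∀ k ≠ j, κ ≤ nodeMap lam mu j z k := by
  obtain ⟨κ, hκ, h⟩ := exists_le_of_selects hd
  have hB : ∀ j, 0 < (mu j - lam j) + (lam (j + 1) + lam (j + 2)) := fun j =>
    add_pos (sub_pos.2 (hlm j)) (add_pos (hlam _) (hlam _))
  obtain ⟨ε, hε, h'⟩ := exists_pos_le
    (fun p : Fin 3 × Fin 3 => lam p.2 * κ / ((mu p.1 - lam p.1) + (lam (p.1 + 1) + lam (p.1 + 2))))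
    (fun p => div_pos (mul_pos (hlam _) hκ) (hB _))
  refine ⟨ε, hε, fun i j z hz hs k hk => (h' (j, k)).trans ?_⟩
  rw [nodeMap_of_ne hk]
  have h1 := sub_pos.2 (hlm j)
  have h2 := add_pos (hlam (j + 1)) (hlam (j + 2))
  have h3 := hz.1 j
  have h4 := le_one_of_mem_side hz j
  refine div_le_div₀ ?_ ?_ (nodeMap_den_pos hlam hlm hz) ?_
  · exact add_nonneg (mul_nonneg h1.le (hz.1 k)) (mul_nonneg (hlam k).le (hz.1 j))
  · have := mul_nonneg h1.le (hz.1 k)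
    have := mul_le_mul_of_nonneg_left (h i j z hz hs) (hlam k).le
    simp only
    linarith
  · rw [nodeMap_den_eq]
    simp only
    nlinarith

/-- The logarithmic coordinate on the side `i`. -/
noncomputable def logRatio (i : Fin 3) (z : Fin 3 → ℝ) : ℝ :=
  Real.log (z (i + 1)) - Real.log (z (i + 2))

/-- The side `A_i` without its two corners. -/
def openSide (i : Fin 3) : Set (Fin 3 → ℝ) := {z | z ∈ side i ∧ ∀ k ≠ i, 0 < z k}

lemma nodeMap_mem_openSide (hlam : ∀ i, 0 < lam i) (hlm : ∀ i, lam i < mu i)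
    (hd : ∀ i, d i ∈ Set.Ioo (0 : ℝ) 1) {i j : Fin 3} {z : Fin 3 → ℝ} (hz : z ∈ side i)
    (hs : Selects d i z j) : nodeMap lam mu j z ∈ openSide j := by
  obtain ⟨κ, hκ, h⟩ := exists_le_nodeMap hlam hlm hd
  exact ⟨nodeMap_mem_side hlam hlm hz, fun k hk => hκ.trans_le (h i j z hz hs k hk)⟩

/-- The point of the open side `i` is recovered continuously from its logarithmic coordinate. -/
lemma apply_eq_of_mem_openSide {i : Fin 3} {z : Fin 3 → ℝ} (hz : z ∈ openSide i) :
    z (i + 1) = 1 - (1 + Real.exp (logRatio i z))⁻¹ ∧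
      z (i + 2) = (1 + Real.exp (logRatio i z))⁻¹ := by
  have h1 := hz.2 _ (add_one_ne i)
  have h2 := hz.2 _ (add_two_ne i)
  have h3 := sum_eq_one_of_mem_side hz.1
  have : z (i + 2) = (1 + Real.exp (logRatio i z))⁻¹ := by
    rw [logRatio, Real.exp_sub, Real.exp_log h1, Real.exp_log h2]
    apply eq_inv_of_mul_eq_one_left
    field_simp
    linarith
  exact ⟨by linarith, this⟩

/-- The inverse of the logarithmic coordinate. -/
noncomputable def ofLogRatio (i : Fin 3) (x : ℝ) : Fin 3 → ℝ := fun k =>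
  if k = i then 0 else if k = i + 1 then 1 - (1 + Real.exp x)⁻¹ else (1 + Real.exp x)⁻¹

lemma continuous_ofLogRatio (i : Fin 3) : Continuous (ofLogRatio i) := by
  have h : Continuous fun x : ℝ => (1 + Real.exp x)⁻¹ :=
    Continuous.inv₀ (by fun_prop) fun x => by positivity
  refine continuous_pi fun k => ?_
  unfold ofLogRatio
  split_ifs <;> fun_prop

lemma ofLogRatio_logRatio {i : Fin 3} {z : Fin 3 → ℝ} (hz : z ∈ openSide i) :
    ofLogRatio i (logRatio i z) = z := by
  obtain ⟨h1, h2⟩ := apply_eq_of_mem_openSide hz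
  funext k
  rcases eq_cyclic i k with rfl | rfl | rfl
  · simp [ofLogRatio, hz.1.2.2]
  · simp [ofLogRatio, ← h1]
  · rw [ofLogRatio, if_neg (add_two_ne i), if_neg (add_one_ne_add_two i).symm, ← h2]

/-- As a function of `log r`, `log (a + c r) - log r` has derivative `-a / (a + c r)`, of modulus at
most `a / (a + c κ)` when `r ≥ κ`. -/
lemma log_add_contract {a c κ : ℝ} (ha : 0 < a) (hc : 0 < c) (hκ : 0 < κ) {r r' : ℝ}
    (hr : κ ≤ r) (hr' : κ ≤ r') :
    |(Real.log (a + c * r) - Real.log r) - (Real.log (a + c * r') - Real.log r')| ≤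
      a / (a + c * κ) * |Real.log r - Real.log r'| := by
  wlog h : r' ≤ r generalizing r r'
  · rw [abs_sub_comm, abs_sub_comm (Real.log r)]
    exact this hr' hr (le_of_not_ge h)
  have hr0' : 0 < r' := hκ.trans_le hr'
  have hr0 : 0 < r := hκ.trans_le hr
  -- With `q = a / (a + c κ)`, monotonicity of `log (a + c x) - (1 - q) log x` is the Lipschitz
  -- bound rearranged.
  have hmono : MonotoneOn (fun x => Real.log (a + c * x) - (1 - a / (a + c * κ)) * Real.log x)
      (Set.Ici κ) := by
    have hpos : ∀ x ∈ Set.Ici κ, 0 < x := fun x hx => hκ.trans_le hx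
    have hder : ∀ x ∈ Set.Ici κ, HasDerivAt
        (fun x => Real.log (a + c * x) - (1 - a / (a + c * κ)) * Real.log x)
        (c / (a + c * x) - (1 - a / (a + c * κ)) * x⁻¹) x := fun x hx => by
      have hx0 := hpos x hx
      have h1 : HasDerivAt (fun x => a + c * x) c x := by
        simpa using ((hasDerivAt_id x).const_mul c).const_add a
      exact (h1.log (by positivity)).sub ((Real.hasDerivAt_log hx0.ne').const_mul _)
    refine monotoneOn_of_deriv_nonneg (convex_Ici κ)
      (fun x hx => (hder x hx).continuousAt.continuousWithinAt)
      (fun x hx => (hder x (interior_subset hx)).differentiableAt.differentiableWithinAt)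
      fun x hx => ?_
    have hx' := interior_subset hx
    have hx0 := hpos x hx'
    rw [(hder x hx').deriv]
    have : c / (a + c * x) - (1 - a / (a + c * κ)) * x⁻¹ =
        c * a * (x - κ) / ((a + c * x) * (a + c * κ) * x) := by
      field_simp
      ring
    rw [this]
    have : 0 ≤ x - κ := sub_nonneg.2 hx'
    positivity
  have h1 := hmono (Set.mem_Ici.2 hr') (Set.mem_Ici.2 hr) h
  have h2 : Real.log r' ≤ Real.log r := Real.log_le_log hr0' h
  have h3 : Real.log (a + c * r) - Real.log r ≤ Real.log (a + c * r') - Real.log r' := by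
    rw [← Real.log_div (by positivity) (by positivity), ← Real.log_div (by positivity) (by positivity)]
    apply Real.log_le_log (by positivity)
    rw [div_le_div_iff₀ hr0 hr0']
    nlinarith
  rw [abs_of_nonpos (by linarith), abs_of_nonneg (by linarith)]
  simp only at h1
  linarith

/-- The common denominator of `nodeMap` cancels in the ratio, and `z i = 0` removes one numerator
term. The two moves differ in sign because the emptied side is oriented differently relative to `i`.
-/
lemma logRatio_nodeMap (hlam : ∀ i, 0 < lam i) (hlm : ∀ i, lam i < mu i) {i : Fin 3}
    {z : Fin 3 → ℝ} (hz : z ∈ openSide i) :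
    logRatio (i + 1) (nodeMap lam mu (i + 1) z) =
      (Real.log ((mu (i + 1) - lam (i + 1)) + lam (i + 2) * (z (i + 1) / z (i + 2))) -
        Real.log (z (i + 1) / z (i + 2))) - Real.log (lam i) ∧
    logRatio (i + 2) (nodeMap lam mu (i + 2) z) =
      Real.log (lam i) -
        (Real.log ((mu (i + 2) - lam (i + 2)) + lam (i + 1) * (z (i + 2) / z (i + 1))) -
        Real.log (z (i + 2) / z (i + 1))) := by
  have h1 := hz.2 _ (add_one_ne i)
  have h2 := hz.2 _ (add_two_ne i)
  have l0 := hlam i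
  have l1 := hlam (i + 1)
  have l2 := hlam (i + 2)
  have m1 := sub_pos.2 (hlm (i + 1))
  have m2 := sub_pos.2 (hlm (i + 2))
  have D1 := nodeMap_den_pos hlam hlm (j := i + 1) hz.1
  have D2 := nodeMap_den_pos hlam hlm (j := i + 2) hz.1
  constructor
  · rw [logRatio, add_one_add_one, add_one_add_two, nodeMap_of_ne (add_one_ne_add_two i).symm,
      nodeMap_of_ne (add_one_ne i).symm, hz.1.2.2, mul_zero, zero_add,
      Real.log_div (by positivity) D1.ne', Real.log_div (by positivity) D1.ne',
      Real.log_mul l0.ne' h1.ne', Real.log_div h1.ne' h2.ne',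
      show (mu (i + 1) - lam (i + 1)) + lam (i + 2) * (z (i + 1) / z (i + 2)) =
        ((mu (i + 1) - lam (i + 1)) * z (i + 2) + lam (i + 2) * z (i + 1)) / z (i + 2) by
        field_simp, Real.log_div (by positivity) h2.ne']
    ring
  · rw [logRatio, add_two_add_one, add_two_add_two, nodeMap_of_ne (add_one_ne_add_two i),
      nodeMap_of_ne (add_two_ne i).symm, hz.1.2.2, mul_zero, zero_add,
      Real.log_div (by positivity) D2.ne', Real.log_div (by positivity) D2.ne',
      Real.log_mul l0.ne' h2.ne', Real.log_div h2.ne' h1.ne',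
      show (mu (i + 2) - lam (i + 2)) + lam (i + 1) * (z (i + 2) / z (i + 1)) =
        ((mu (i + 2) - lam (i + 2)) * z (i + 1) + lam (i + 1) * z (i + 2)) / z (i + 1) by
        field_simp, Real.log_div (by positivity) h1.ne']
    ring

/-- The maps `f_j` are uniform contractions in the logarithmic coordinates. -/
lemma exists_logRatio_contract (hlam : ∀ i, 0 < lam i) (hlm : ∀ i, lam i < mu i)
    (hd : ∀ i, d i ∈ Set.Ioo (0 : ℝ) 1) :
    ∃ c, 0 ≤ c ∧ c < 1 ∧ ∀ i j z u, z ∈ openSide i → u ∈ openSide i → Selects d i z j →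
      Selects d i u j → |logRatio j (nodeMap lam mu j z) - logRatio j (nodeMap lam mu j u)| ≤
        c * |logRatio i z - logRatio i u| := by
  obtain ⟨κ, hκ, hsel⟩ := exists_le_of_selects hd
  have ha : ∀ j, 0 < mu j - lam j := fun j => sub_pos.2 (hlm j)
  obtain ⟨ε, hε, hle⟩ := exists_pos_le
    (fun p : Fin 3 × Fin 3 => 1 - (mu p.1 - lam p.1) / ((mu p.1 - lam p.1) + lam p.2 * κ))
    (fun p => by
      have := ha p.1
      have := hlam p.2
      rw [sub_pos, div_lt_one (by positivity)]
      have : 0 < lam p.2 * κ := by positivity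
      linarith)
  have hc : ∀ j k, (mu j - lam j) / ((mu j - lam j) + lam k * κ) ≤ 1 - ε := fun j k => by
    have := hle (j, k)
    simp only at this
    linarith
  -- The selected coordinate is at least `κ` and the other one at most `1`.
  have hge : ∀ i j k z, z ∈ openSide i → Selects d i z j → k ≠ i → κ ≤ z j / z k := by
    intro i j k z hz hs hk
    rw [le_div_iff₀ (hz.2 k hk)]
    have h1 := hsel i j z hz.1 hs
    have h2 := le_one_of_mem_side hz.1 k
    nlinarith
  refine ⟨1 - ε, ?_, by linarith, fun i j z u hz hu hzs hus => ?_⟩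
  · have h := hc 0 0
    have : 0 < (mu 0 - lam 0) / ((mu 0 - lam 0) + lam 0 * κ) :=
      div_pos (ha 0) (add_pos (ha 0) (mul_pos (hlam 0) hκ))
    linarith
  have z1 := hz.2 _ (add_one_ne i)
  have z2 := hz.2 _ (add_two_ne i)
  have u1 := hu.2 _ (add_one_ne i)
  have u2 := hu.2 _ (add_two_ne i)
  rcases hzs with ⟨rfl, hzs'⟩ | ⟨rfl, hzs'⟩
  · have hzs : Selects d i z (i + 1) := Or.inl ⟨rfl, hzs'⟩
    rw [(logRatio_nodeMap hlam hlm hz).1, (logRatio_nodeMap hlam hlm hu).1, sub_sub_sub_cancel_right]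
    refine (log_add_contract (ha _) (hlam _) hκ (hge i _ _ z hz hzs (add_two_ne i))
      (hge i _ _ u hu hus (add_two_ne i))).trans ?_
    rw [Real.log_div z1.ne' z2.ne', Real.log_div u1.ne' u2.ne']
    exact mul_le_mul_of_nonneg_right (hc _ _) (abs_nonneg _)
  · have hzs : Selects d i z (i + 2) := Or.inr ⟨rfl, hzs'⟩
    rw [(logRatio_nodeMap hlam hlm hz).2, (logRatio_nodeMap hlam hlm hu).2, sub_sub_sub_cancel_left,
      abs_sub_comm]
    refine (log_add_contract (ha _) (hlam _) hκ (hge i _ _ z hz hzs (add_one_ne i))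
      (hge i _ _ u hu hus (add_one_ne i))).trans ?_
    rw [Real.log_div z2.ne' z1.ne', Real.log_div u2.ne' u1.ne',
      show Real.log (z (i + 2)) - Real.log (z (i + 1)) - (Real.log (u (i + 2)) - Real.log (u (i + 1)))
        = -(logRatio i z - logRatio i u) by simp only [logRatio]; ring, abs_neg]
    exact mul_le_mul_of_nonneg_right (hc _ _) (abs_nonneg _)

end Polling

namespace Polling

/-! ### Pseudo-trajectories of the triangle process -/

variable {lam mu d : Fin 3 → ℝ}

lemma isClosed_side (i : Fin 3) : IsClosed (side i) := by
  have h : side i = {z | ∀ k, 0 ≤ z k} ∩ ({z | ∑ k, z k = 1} ∩ {z | z i = 0}) := rfl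
  rw [h]
  refine IsClosed.inter ?_ (IsClosed.inter ?_ ?_)
  · simp only [Set.ofPred_forall]
    exact isClosed_iInter fun k => isClosed_le continuous_const (continuous_apply k)
  · exact isClosed_eq (by fun_prop) continuous_const
  · exact isClosed_eq (continuous_apply i) continuous_const

lemma eq_of_mem_openSide_of_mem_side {i j : Fin 3} {z : Fin 3 → ℝ} (hz : z ∈ openSide i)
    (hz' : z ∈ side j) : j = i := by
  by_contra h
  exact (hz.2 j h).ne' hz'.2.2

/-- Closedness rests on both moves being allowed in a tie; it lets the rule pass to limits. -/
lemma isClosed_selects (i j : Fin 3) : IsClosed {z | Selects d i z j} := by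
  simp only [Selects, Set.ofPred_or, Set.ofPred_and]
  exact ((isClosed_const).inter (isClosed_le (by fun_prop) (by fun_prop))).union
    ((isClosed_const).inter (isClosed_le (by fun_prop) (by fun_prop)))

lemma abs_log_sub_log_le {κ a b : ℝ} (hκ : 0 < κ) (ha : κ ≤ a) (hb : κ ≤ b) :
    |Real.log a - Real.log b| ≤ |a - b| / κ := by
  wlog h : b ≤ a generalizing a b
  · rw [abs_sub_comm, abs_sub_comm a]
    exact this hb ha (le_of_not_ge h)
  have ha0 : 0 < a := hκ.trans_le ha
  have hb0 : 0 < b := hκ.trans_le hb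
  have h1 : Real.log b ≤ Real.log a := Real.log_le_log hb0 h
  rw [abs_of_nonneg (sub_nonneg.2 h1), abs_of_nonneg (sub_nonneg.2 h), ← Real.log_div ha0.ne' hb0.ne']
  calc Real.log (a / b) ≤ a / b - 1 := Real.log_le_sub_one_of_pos (by positivity)
    _ = (a - b) / b := by field_simp
    _ ≤ (a - b) / κ := div_le_div_of_nonneg_left (sub_nonneg.2 h) hκ hb

/-- Once `η ≤ (1 - c) ε / 2`, the affine recursion has fixed point `ε / 2` and the excess over it
decays like `c ^ r`. -/
lemma tendsto_zero_of_contract {c : ℝ} (hc0 : 0 ≤ c) (hc1 : c < 1) {δ η : ℕ → ℝ}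
    (hδ : ∀ k, 0 ≤ δ k) (hη : Tendsto η atTop (𝓝 0)) (h : ∀ k, δ (k + 1) ≤ c * δ k + η k) :
    Tendsto δ atTop (𝓝 0) := by
  rw [Metric.tendsto_atTop]
  intro ε hε
  have hpos : 0 < (1 - c) * (ε / 2) := mul_pos (sub_pos.2 hc1) (half_pos hε)
  obtain ⟨K, hK⟩ := eventually_atTop.1 (hη.eventually_le_const hpos)
  have hr : ∀ r, δ (K + r) ≤ c ^ r * δ K + ε / 2 := by
    intro r
    induction r with
    | zero => simp; positivity
    | succ r ih =>
      have h1 := h (K + r)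
      have h2 := hK (K + r) (by omega)
      have h3 := mul_le_mul_of_nonneg_left ih hc0
      rw [← add_assoc, pow_succ]
      linarith
  have hlim : Tendsto (fun r => c ^ r * δ K) atTop (𝓝 0) := by
    simpa using (tendsto_pow_atTop_nhds_zero_of_lt_one hc0 hc1).mul_const (δ K)
  obtain ⟨R, hR⟩ := eventually_atTop.1 (hlim.eventually_lt_const (half_pos hε))
  refine ⟨K + R, fun n hn => ?_⟩
  have h1 := hr (n - K)
  have h2 := hR (n - K) (by omega)
  rw [Nat.add_sub_cancel' (by omega)] at h1
  rw [Real.dist_eq, sub_zero, abs_of_nonneg (hδ n)]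
  linarith

/-- Images under a selected `f_j` stay at distance `κ` from the corners, where the logarithm is
Lipschitz, so errors in the simplex become errors in the logarithmic coordinate. -/
lemma tendsto_logRatio_sub (hlam : ∀ i, 0 < lam i) (hlm : ∀ i, lam i < mu i)
    (hd : ∀ i, d i ∈ Set.Ioo (0 : ℝ) 1) {z : ℕ → Fin 3 → ℝ} {i : ℕ → Fin 3}
    (hside : ∀ n, z n ∈ side (i n)) (hsel : ∀ n, Selects d (i n) (z n) (i (n + 1)))
    (herr : Tendsto (fun n => z (n + 1) - nodeMap lam mu (i (n + 1)) (z n)) atTop (𝓝 0)) :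
    (∀ᶠ n in atTop, z (n + 1) ∈ openSide (i (n + 1))) ∧
    Tendsto (fun n => logRatio (i (n + 1)) (z (n + 1)) -
      logRatio (i (n + 1)) (nodeMap lam mu (i (n + 1)) (z n))) atTop (𝓝 0) := by
  obtain ⟨κ, hκ, hle⟩ := exists_le_nodeMap hlam hlm hd
  have hnorm : Tendsto (fun n => ‖z (n + 1) - nodeMap lam mu (i (n + 1)) (z n)‖) atTop (𝓝 0) := by
    simpa using herr.norm
  have hk : ∀ n k, |z (n + 1) k - nodeMap lam mu (i (n + 1)) (z n) k| ≤
      ‖z (n + 1) - nodeMap lam mu (i (n + 1)) (z n)‖ := fun n k => norm_le_pi_norm (z (n + 1) - _) k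
  have hge : ∀ᶠ n in atTop, ∀ k ≠ i (n + 1), κ / 2 ≤ z (n + 1) k := by
    filter_upwards [hnorm.eventually_le_const (half_pos hκ)] with n hn k hki
    have h1 := hle _ _ _ (hside n) (hsel n) k hki
    have h2 := (abs_le.1 ((hk n k).trans hn)).1
    linarith
  refine ⟨?_, ?_⟩
  · filter_upwards [hge] with n hn
    exact ⟨hside _, fun k hki => (half_pos hκ).trans_le (hn k hki)⟩
  · have hlim : Tendsto (fun n => ‖z (n + 1) - nodeMap lam mu (i (n + 1)) (z n)‖ / (κ / 2) +
        ‖z (n + 1) - nodeMap lam mu (i (n + 1)) (z n)‖ / (κ / 2)) atTop (𝓝 0) := by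
      simpa using (hnorm.div_const (κ / 2)).add (hnorm.div_const (κ / 2))
    refine squeeze_zero_norm' ?_ hlim
    filter_upwards [hge] with n hn
    have key : ∀ k ≠ i (n + 1),
        |Real.log (z (n + 1) k) - Real.log (nodeMap lam mu (i (n + 1)) (z n) k)| ≤
          ‖z (n + 1) - nodeMap lam mu (i (n + 1)) (z n)‖ / (κ / 2) := fun k hki => by
      have h1 := hle _ _ _ (hside n) (hsel n) k hki
      refine (abs_log_sub_log_le (half_pos hκ) (hn k hki) (by linarith)).trans ?_
      gcongr
      exact hk n k
    have h1 := key _ (add_one_ne _)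
    have h2 := key _ (add_two_ne _)
    rw [Real.norm_eq_abs, logRatio, logRatio, sub_sub_sub_comm]
    exact (abs_sub _ _).trans (add_le_add h1 h2)

/-- A single ultrafilter makes all the shifts converge at once and replaces a diagonal extraction.
-/
lemma exists_tendsto_ultrafilter {X : Type*} [TopologicalSpace X] {K : Set X} (hK : IsCompact K)
    (𝒰 : Ultrafilter ℕ) (f : ℕ → X) (hf : ∀ n, f n ∈ K) : ∃ x ∈ K, Tendsto f 𝒰 (𝓝 x) :=
  hK.ultrafilter_le_nhds (𝒰.map f) (by
    rw [le_principal_iff]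
    exact Filter.mem_map.2 (Filter.univ_mem' hf))

/-- The limits along an ultrafilter of the shifts of a pseudo-trajectory form a trajectory. -/
lemma exists_limit_trajectory (hlam : ∀ i, 0 < lam i) (hlm : ∀ i, lam i < mu i)
    {z : ℕ → Fin 3 → ℝ} {i : ℕ → Fin 3}
    (hside : ∀ n, z n ∈ side (i n)) (hsel : ∀ n, Selects d (i n) (z n) (i (n + 1)))
    (herr : Tendsto (fun n => z (n + 1) - nodeMap lam mu (i (n + 1)) (z n)) atTop (𝓝 0))
    (𝒰 : Ultrafilter ℕ) (h𝒰 : (𝒰 : Filter ℕ) ≤ atTop) :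
    ∃ w, IsTrajectory lam mu d w ∧ ∀ t, Tendsto (fun n => z (n + t)) 𝒰 (𝓝 (w t)) := by
  have hK : IsCompact (stdSimplex ℝ (Fin 3)) := isCompact_stdSimplex ℝ (Fin 3)
  choose w hwK hw using fun t => exists_tendsto_ultrafilter hK 𝒰 (fun n => z (n + t))
    (fun n => ⟨(hside _).1, (hside _).2.1⟩)
  choose ι hι' hι using fun t => exists_tendsto_ultrafilter (isCompact_univ (X := Fin 3)) 𝒰
    (fun n => i (n + t)) (fun n => Set.mem_univ _)
  -- Nodes are discrete, so convergence along `𝒰` means that the node is eventually constant.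
  have hι : ∀ t, ∀ᶠ n in (𝒰 : Filter ℕ), i (n + t) = ι t := fun t => by
    have := hι t
    rwa [nhds_discrete, tendsto_pure] at this
  have hwside : ∀ t, w t ∈ side (ι t) := fun t =>
    (isClosed_side (ι t)).mem_of_tendsto (hw t) (by
      filter_upwards [hι t] with n hn
      rw [← hn]
      exact hside _)
  refine ⟨w, ⟨Set.mem_iUnion.2 ⟨_, hwside 0⟩, fun t => ⟨ι t, ι (t + 1), hwside t, ?_, ?_⟩⟩, hw⟩
  · refine (isClosed_selects (ι t) (ι (t + 1))).mem_of_tendsto (hw t) ?_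
    filter_upwards [hι t, hι (t + 1)] with n hn hn'
    have := hsel (n + t)
    rw [hn] at this
    rw [add_assoc, hn'] at this
    exact this
  · have h1 : Tendsto (fun n => nodeMap lam mu (ι (t + 1)) (z (n + t))) 𝒰
        (𝓝 (nodeMap lam mu (ι (t + 1)) (w t))) := by
      refine (continuousOn_nodeMap hlam hlm (ι t) (ι (t + 1)) (w t) (hwside t)).tendsto.comp
        (tendsto_nhdsWithin_iff.2 ⟨hw t, ?_⟩)
      filter_upwards [hι t] with n hn
      rw [← hn]
      exact hside _
    have h2 : Tendsto (fun n => z (n + (t + 1)) - nodeMap lam mu (i (n + (t + 1))) (z (n + t))) 𝒰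
        (𝓝 0) := by
      have := (herr.comp (tendsto_add_atTop_nat t)).mono_left h𝒰
      exact this
    have h3 : Tendsto (fun n => z (n + (t + 1))) 𝒰 (𝓝 (nodeMap lam mu (ι (t + 1)) (w t))) := by
      have h4 := h2.add h1
      rw [zero_add] at h4
      refine h4.congr' ?_
      filter_upwards [hι (t + 1)] with n hn
      rw [hn, sub_add_cancel]
    exact tendsto_nhds_unique (hw (t + 1)) h3

/-- The sides visited by a periodic orbit. -/
lemma IsPeriodicOrbit.exists_sides (hlam : ∀ i, 0 < lam i) (hlm : ∀ i, lam i < mu i)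
    (hd : ∀ i, d i ∈ Set.Ioo (0 : ℝ) 1) {m : ℕ} {u : ℕ → Fin 3 → ℝ}
    (h : IsPeriodicOrbit lam mu d m u) :
    ∃ σ : ℕ → Fin 3, (∀ n, σ (n + m) = σ n) ∧ ∀ n, u n ∈ openSide (σ n) ∧
      Selects d (σ n) (u n) (σ (n + 1)) ∧ u (n + 1) = nodeMap lam mu (σ (n + 1)) (u n) := by
  obtain ⟨hm, hper, hstep⟩ := h
  -- By periodicity every point, `u 0` included, is the image of a predecessor, here the one with
  -- index `n + m - 1`, and images are never corners.
  have hopen : ∀ n, ∃ j, u n ∈ openSide j := fun n => by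
    obtain ⟨i, j, hz, hs, he⟩ := hstep (n + m - 1)
    rw [Nat.sub_add_cancel (by omega), hper] at he
    exact ⟨j, he ▸ nodeMap_mem_openSide hlam hlm hd hz hs⟩
  choose σ hσ using hopen
  refine ⟨σ, fun n => ?_, fun n => ⟨hσ n, ?_⟩⟩
  · have := (hσ (n + m)).1
    rw [hper] at this
    exact eq_of_mem_openSide_of_mem_side (hσ n) this
  · obtain ⟨i, j, hz, hs, he⟩ := hstep n
    have hi := eq_of_mem_openSide_of_mem_side (hσ n) hz
    have hj := eq_of_mem_openSide_of_mem_side (hσ (n + 1))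
      (he ▸ nodeMap_mem_side hlam hlm hz : u (n + 1) ∈ side j)
    subst hi hj
    exact ⟨hs, he⟩

/-- Away from the decision points the threshold rule makes the same choice on a neighbourhood. -/
lemma exists_selects_unique {i j : Fin 3} {u : Fin 3 → ℝ} (hu : u ∈ openSide i)
    (hne : u ≠ decisionPoint d i) (hs : Selects d i u j) :
    ∃ ε > 0, ∀ x ∈ openSide i, |logRatio i x - logRatio i u| < ε →
      ∀ j', Selects d i x j' → j' = j := by
  have hcont : Continuous fun x : ℝ => (1 + Real.exp x)⁻¹ :=
    Continuous.inv₀ (by fun_prop) fun x => by positivity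
  have hu2 := (apply_eq_of_mem_openSide hu).2
  have hne' : u (i + 2) ≠ d i := fun h => hne <| by
    have h1 := sum_eq_one_of_mem_side hu.1
    funext k
    rcases eq_cyclic i k with rfl | rfl | rfl
    · simp [decisionPoint, hu.1.2.2]
    · simp only [decisionPoint, if_true]; linarith
    · rw [decisionPoint, if_neg (add_one_ne_add_two i).symm, if_pos rfl, h]
  rcases hne'.lt_or_gt with hlt | hlt
  · have hev := hcont.continuousAt.eventually_lt (x₀ := logRatio i u) continuousAt_const (hu2 ▸ hlt)
    obtain ⟨ε, hε, hball⟩ := Metric.eventually_nhds_iff.1 hev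
    refine ⟨ε, hε, fun x hx hxu j' hj' => ?_⟩
    have hx2 := hball hxu
    rw [← (apply_eq_of_mem_openSide hx).2] at hx2
    rcases (selects_iff_of_mem_side hu.1).1 hs with ⟨rfl, -⟩ | ⟨-, h⟩
    · rcases (selects_iff_of_mem_side hx.1).1 hj' with ⟨rfl, -⟩ | ⟨-, h⟩
      · rfl
      · exact absurd hx2 h.not_gt
    · exact absurd hlt h.not_gt
  · have hev := continuousAt_const.eventually_lt (x₀ := logRatio i u) hcont.continuousAt (hu2 ▸ hlt)
    obtain ⟨ε, hε, hball⟩ := Metric.eventually_nhds_iff.1 hev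
    refine ⟨ε, hε, fun x hx hxu j' hj' => ?_⟩
    have hx2 := hball hxu
    rw [← (apply_eq_of_mem_openSide hx).2] at hx2
    rcases (selects_iff_of_mem_side hu.1).1 hs with ⟨-, h⟩ | ⟨rfl, -⟩
    · exact absurd hlt h.not_gt
    · rcases (selects_iff_of_mem_side hx.1).1 hj' with ⟨-, h⟩ | ⟨rfl, -⟩
      · exact absurd hx2 h.not_gt
      · rfl

/-- A pseudo-trajectory, that is, a sequence which follows the triangle process up to an error that
tends to zero, converges onto a periodic orbit, and the nodes it visits are eventually periodic. -/
theorem exists_convergesOnto_of_pseudoTrajectory (hlam : ∀ i, 0 < lam i)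
    (hlm : ∀ i, lam i < mu i) (hd : ∀ i, d i ∈ Set.Ioo (0 : ℝ) 1)
    (hstable : IsStable lam mu d) (havoid : OrbitsAvoidDecisionPoints lam mu d)
    {z : ℕ → Fin 3 → ℝ} {i : ℕ → Fin 3}
    (hside : ∀ n, z n ∈ side (i n)) (hsel : ∀ n, Selects d (i n) (z n) (i (n + 1)))
    (herr : Tendsto (fun n => z (n + 1) - nodeMap lam mu (i (n + 1)) (z n)) atTop (𝓝 0)) :
    ∃ m u, IsPeriodicOrbit lam mu d m u ∧ ConvergesOnto z m u ∧
      ∃ N, ∀ n ≥ N, i (n + m) = i n := by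
  obtain ⟨w, hw, hzw⟩ := exists_limit_trajectory hlam hlm hside hsel herr (hyperfilter ℕ)
    Nat.hyperfilter_le_atTop
  obtain ⟨m, u, hu, n₀, hconv⟩ := hstable.2 w hw
  obtain ⟨σ, hσper, hσ⟩ := hu.exists_sides hlam hlm hd
  have hm := hu.1
  refine ⟨m, u, hu, ?_⟩
  obtain ⟨c, hc0, hc1, hcontr⟩ := exists_logRatio_contract hlam hlm hd
  obtain ⟨hopen, hlog⟩ := tendsto_logRatio_sub hlam hlm hd hside hsel herr
  -- a uniform size of the neighbourhoods of the orbit in which its moves are imitated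
  have hgap : ∃ ε > 0, ∀ n, ∀ x ∈ openSide (σ n), |logRatio (σ n) x - logRatio (σ n) (u n)| < ε →
      ∀ j, Selects d (σ n) x j → j = σ (n + 1) := by
    choose f hf0 hf using fun n => exists_selects_unique (hσ n).1
      (fun h => havoid _ ⟨m, u, hu, rfl⟩ (σ n) ⟨n, h⟩) (hσ n).2.1
    obtain ⟨ε, hε, hle⟩ := exists_pos_le (fun n : Fin m => f n) (fun n => hf0 n)
    refine ⟨ε, hε, fun n x hx hxu j hj => ?_⟩
    have e1 : σ (n % m) = σ n := Function.Periodic.map_mod_nat hσper n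
    have e2 : u (n % m) = u n := Function.Periodic.map_mod_nat hu.2.1 n
    have e3 : σ (n % m + 1) = σ (n + 1) := by
      have : Function.Periodic (fun n => σ (n + 1)) m := fun n => by
        show σ (n + m + 1) = σ (n + 1)
        rw [add_right_comm, hσper]
      exact this.map_mod_nat n
    rw [← e3]
    refine hf (n % m) x (e1 ▸ hx) ?_ j (e1 ▸ hj)
    rw [e1, e2]
    exact hxu.trans_le (hle ⟨n % m, Nat.mod_lt _ hm⟩)
  obtain ⟨ε, hε, hgap⟩ := hgap
  -- the pseudo-trajectory enters such a neighbourhood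
  have hV : ∀ᶠ x in 𝓝 (u 0), (∀ k ≠ σ 0, 0 < x k) ∧
      |logRatio (σ 0) x - logRatio (σ 0) (u 0)| < ε := by
    have hpos := (hσ 0).1.2
    refine (eventually_all.2 fun k => ?_).and ?_
    · by_cases hk : k = σ 0
      · exact Eventually.of_forall fun x h => absurd hk h
      · filter_upwards [continuousAt_const.eventually_lt (continuous_apply k).continuousAt (hpos k hk)] with x hx _
        exact hx
    · have hca : ContinuousAt (logRatio (σ 0)) (u 0) := by
        have h1 : ContinuousAt (fun x : Fin 3 → ℝ => x (σ 0 + 1)) (u 0) :=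
          (continuous_apply _).continuousAt
        have h2 : ContinuousAt (fun x : Fin 3 → ℝ => x (σ 0 + 2)) (u 0) :=
          (continuous_apply _).continuousAt
        exact (h1.log (hpos _ (add_one_ne _)).ne').sub (h2.log (hpos _ (add_two_ne _)).ne')
      exact Metric.continuousAt_iff'.1 hca ε hε
  -- The limit trajectory reaches a point near which `hV` still holds; the pseudo-trajectory is
  -- close to that point at arbitrarily late times.
  obtain ⟨t, ht⟩ := ((hconv 0 hm).eventually (eventually_eventually_nhds.2 hV)).exists
  have hfreq := ((hzw _).eventually ht).frequently.filter_mono Nat.hyperfilter_le_atTop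
  -- An error below `(1 - c) ε` added to a contracted distance below `c ε` stays below `ε`, so the
  -- neighbourhood traps.
  have hη : 0 < (1 - c) * ε := mul_pos (sub_pos.2 hc1) hε
  have hsmall : ∀ᶠ n in atTop, |logRatio (i (n + 1)) (z (n + 1)) -
      logRatio (i (n + 1)) (nodeMap lam mu (i (n + 1)) (z n))| < (1 - c) * ε := by
    have h := hlog.abs
    rw [abs_zero] at h
    exact h.eventually_lt_const hη
  obtain ⟨N₁, hN₁⟩ := eventually_atTop.1 (hopen.and hsmall)
  obtain ⟨n₁, ⟨hn₁, hn₁'⟩, hge⟩ := (hfreq.and_eventually (eventually_ge_atTop N₁)).exists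
  obtain ⟨N, hN, hNge⟩ : ∃ N, N = n₁ + (m * t + 0 + n₀) ∧ N₁ ≤ N := ⟨_, rfl, by omega⟩
  rw [← hN] at hn₁ hn₁'
  have hrec : ∀ k, i (N + k) = σ k → z (N + k) ∈ openSide (σ k) →
      |logRatio (σ k) (z (N + k)) - logRatio (σ k) (u k)| < ε →
      i (N + k + 1) = σ (k + 1) ∧
      |logRatio (σ (k + 1)) (z (N + k + 1)) - logRatio (σ (k + 1)) (u (k + 1))| ≤
        c * |logRatio (σ k) (z (N + k)) - logRatio (σ k) (u k)| +
        |logRatio (i (N + k + 1)) (z (N + k + 1)) -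
          logRatio (i (N + k + 1)) (nodeMap lam mu (i (N + k + 1)) (z (N + k)))| := by
    intro k hik hzk hlt
    have hs := hsel (N + k)
    rw [hik] at hs
    have hi := hgap k _ hzk hlt _ hs
    rw [hi] at hs ⊢
    refine ⟨rfl, ?_⟩
    have h1 := hcontr _ _ _ _ hzk (hσ k).1 hs (hσ k).2.1
    rw [(hσ k).2.2, add_comm (c * _)]
    exact (abs_sub_le _ _ _).trans (add_le_add le_rfl h1)
  have htrap : ∀ k, i (N + k) = σ k ∧ z (N + k) ∈ openSide (σ k) ∧
      |logRatio (σ k) (z (N + k)) - logRatio (σ k) (u k)| < ε := by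
    intro k
    induction k with
    | zero =>
      have hi : i N = σ 0 := by
        by_contra h
        exact (hn₁ _ h).ne' (hside N).2.2
      exact ⟨hi, ⟨hi ▸ hside N, hn₁⟩, hn₁'⟩
    | succ k ih =>
      obtain ⟨h1, h2⟩ := hrec k ih.1 ih.2.1 ih.2.2
      have h3 := hN₁ (N + k) (by omega)
      refine ⟨h1, ?_, ?_⟩
      · have := h3.1
        rwa [h1] at this
      · rw [← add_assoc]
        refine h2.trans_lt ?_
        have h4 := h3.2
        have h5 := ih.2.2
        have := mul_le_mul_of_nonneg_left h5.le hc0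
        linarith
  have hδ : Tendsto (fun k => |logRatio (σ k) (z (N + k)) - logRatio (σ k) (u k)|) atTop (𝓝 0) := by
    refine tendsto_zero_of_contract hc0 hc1 (fun k => abs_nonneg _) (η := fun k =>
      |logRatio (i (N + k + 1)) (z (N + k + 1)) -
        logRatio (i (N + k + 1)) (nodeMap lam mu (i (N + k + 1)) (z (N + k)))|) ?_
      fun k => (hrec k (htrap k).1 (htrap k).2.1 (htrap k).2.2).2
    have h := (hlog.comp (tendsto_add_atTop_nat N)).abs
    rw [abs_zero] at h
    refine h.congr fun k => ?_
    simp only [Function.comp, add_comm k N]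
  refine ⟨⟨N, fun n hn => ?_⟩, N, fun n hn => ?_⟩
  · have hσ' : ∀ t, σ (m * t + n) = σ n := fun t => by
      rw [← Function.Periodic.map_mod_nat hσper, Nat.mul_add_mod,
        Function.Periodic.map_mod_nat hσper]
    have hu' : ∀ t, u (m * t + n) = u n := fun t => by
      rw [← Function.Periodic.map_mod_nat hu.2.1, Nat.mul_add_mod,
        Function.Periodic.map_mod_nat hu.2.1]
    have hsub : Tendsto (fun t : ℕ => m * t + n) atTop atTop :=
      tendsto_atTop_mono
        (fun t => (Nat.le_mul_of_pos_left t hm).trans (Nat.le_add_right _ n)) tendsto_id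
    have h1 := hδ.comp hsub
    simp only [Function.comp_def, hσ', hu'] at h1
    have h2 : Tendsto (fun t => logRatio (σ n) (z (N + (m * t + n)))) atTop
        (𝓝 (logRatio (σ n) (u n))) := tendsto_iff_norm_sub_tendsto_zero.2 h1
    have h3 := ((continuous_ofLogRatio (σ n)).tendsto _).comp h2
    rw [ofLogRatio_logRatio (hσ n).1] at h3
    refine h3.congr fun t => ?_
    have h4 := (htrap (m * t + n)).2.1
    rw [hσ'] at h4
    simp only [Function.comp, ofLogRatio_logRatio h4]
    rw [add_comm N]
  · have h1 := (htrap (n - N)).1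
    have h2 := (htrap (n - N + m)).1
    rw [hσper, ← h1, show N + (n - N + m) = n + m by omega, show N + (n - N) = n by omega] at h2
    exact h2

end Polling

namespace Polling

/-! ### Sample paths of the polling system -/

/-- A sample path of the polling system in which the queue lengths during the services are written
as their drift plus a noise `D` whose averages tend to zero. -/
structure IsDrivenPath (lam mu d : Fin 3 → ℝ) (ξ : ℕ → Fin 3 → ℕ) (s : ℕ → Fin 3)
    (D : ℕ → Fin 3 → ℝ) : Prop where
  service : ∀ t, 0 < ξ t (s t) → s (t + 1) = s t ∧ ∀ k, (ξ (t + 1) k : ℝ) =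
    ξ t k + (lam k / mu (s t) - if k = s t then 1 else 0) + D t k
  switch : ∀ t, ξ t (s t) = 0 → ξ t ≠ 0 →
    ξ (t + 1) = ξ t ∧ Selects d (s t) (fun i => (ξ t i : ℝ)) (s (t + 1)) ∧ D t = 0
  idle : ∀ t, ξ t = 0 → s (t + 1) = s t ∧ ξ (t + 1) ≠ 0 ∧ D t = 0
  noise : ∀ k, Tendsto (fun t : ℕ => (∑ r ∈ Finset.range t, D r k) / t) atTop (𝓝 0)

variable {lam mu d : Fin 3 → ℝ} {ξ : ℕ → Fin 3 → ℕ} {s : ℕ → Fin 3} {D : ℕ → Fin 3 → ℝ}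

/-- Since `0 < d i < 1`, selecting an empty node would force the third node to be empty too. Hence
every switch is followed by a service. -/
lemma Selects.apply_pos {i j : Fin 3} {y : Fin 3 → ℕ} (hd : ∀ i, d i ∈ Set.Ioo (0 : ℝ) 1)
    (h : Selects d i (fun k => (y k : ℝ)) j) (hi : y i = 0) (hy : y ≠ 0) : 0 < y j := by
  by_contra hj
  apply hy
  have hj : y j = 0 := by omega
  funext k
  obtain ⟨h0, h1⟩ := hd i
  rcases h with ⟨rfl, h⟩ | ⟨rfl, h⟩
  · simp only [hj, Nat.cast_zero, zero_add] at h
    have h2 : (y (i + 2) : ℝ) = 0 := by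
      have : (0 : ℝ) ≤ y (i + 2) := Nat.cast_nonneg _
      nlinarith
    rcases eq_cyclic i k with rfl | rfl | rfl
    · exact hi
    · exact hj
    · exact_mod_cast h2
  · simp only [hj, Nat.cast_zero, add_zero] at h
    have h2 : (y (i + 1) : ℝ) = 0 := by
      have : (0 : ℝ) ≤ y (i + 1) := Nat.cast_nonneg _
      nlinarith
    rcases eq_cyclic i k with rfl | rfl | rfl
    · exact hi
    · exact_mod_cast h2
    · exact hj

namespace IsDrivenPath

lemma eventually_abs_noise_le (h : IsDrivenPath lam mu d ξ s D) {ε : ℝ} (hε : 0 < ε) :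
    ∀ᶠ t : ℕ in atTop, ∀ k, |∑ r ∈ Finset.range t, D r k| ≤ ε * t := by
  refine eventually_all.2 fun k => ?_
  have h1 := (h.noise k).abs
  rw [abs_zero] at h1
  filter_upwards [h1.eventually_le_const hε, eventually_gt_atTop 0] with t ht ht0
  have ht0 : (0 : ℝ) < t := Nat.cast_pos.2 ht0
  rwa [abs_div, abs_of_pos ht0, div_le_iff₀ ht0] at ht

/-- The workload grows at least linearly: every switch is followed by a service, and every arrival
at an empty system by a service or a switch, so that at least a third of the steps are services. -/
lemma exists_linear_growth (h : IsDrivenPath lam mu d ξ s D) (hmu : ∀ i, 0 < mu i)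
    (hload : 1 < ∑ i, lam i / mu i) (hd : ∀ i, d i ∈ Set.Ioo (0 : ℝ) 1) :
    ∃ c > 0, ∀ᶠ t : ℕ in atTop, c * t ≤ ∑ k, (ξ t k : ℝ) := by
  -- A service at `j` raises the mean workload by `(∑ λ_i/μ_i - 1)/μ_j`; `δ` is a lower bound over
  -- the nodes.
  obtain ⟨δ, hδ, hδle⟩ := exists_pos_le (fun j => (∑ i, lam i / mu i - 1) / mu j)
    (fun j => div_pos (sub_pos.2 hload) (hmu j))
  set W : ℕ → ℝ := fun t => ∑ k, (ξ t k : ℝ) / mu k with hW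
  -- `g` bounds the number of steps before the next service. Apart from noise, `W - (δ/3) g` gains
  -- at least `δ/3` in every step: a service gains `δ` and loses at most `2δ/3`, and the other steps
  -- lower `g` by at least one.
  set g : ℕ → ℝ := fun t => if ξ t = 0 then 2 else if ξ t (s t) = 0 then 1 else 0 with hg
  have hg0 : ∀ t, 0 ≤ g t := fun t => by simp only [hg]; split_ifs <;> norm_num
  have hg2 : ∀ t, g t ≤ 2 := fun t => by simp only [hg]; split_ifs <;> norm_num
  have hW0 : ∀ t, 0 ≤ W t := fun t =>
    Finset.sum_nonneg fun k _ => div_nonneg (Nat.cast_nonneg _) (hmu k).le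
  have hstep : ∀ t, W t - δ / 3 * g t + δ / 3 + ∑ k, D t k / mu k ≤
      W (t + 1) - δ / 3 * g (t + 1) := by
    intro t
    rcases Nat.eq_zero_or_pos (ξ t (s t)) with h0 | hpos
    · by_cases hz : ξ t = 0
      · obtain ⟨-, h2, h3⟩ := h.idle t hz
        have e1 : g t = 2 := by simp [hg, hz]
        have e2 : g (t + 1) ≤ 1 := by
          simp only [hg, if_neg h2]; split_ifs <;> norm_num
        have e3 : W t = 0 := by simp [hW, hz]
        have e4 := hW0 (t + 1)
        simp only [h3, Pi.zero_apply, zero_div, Finset.sum_const_zero, e1, e3]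
        nlinarith
      · obtain ⟨h1, h2, h3⟩ := h.switch t h0 hz
        have e1 : g t = 1 := by simp [hg, hz, h0]
        have e2 : g (t + 1) = 0 := by
          have := h2.apply_pos hd h0 hz
          simp [hg, h1, hz, this.ne']
        have e3 : W (t + 1) = W t := by simp [hW, h1]
        simp only [h3, Pi.zero_apply, zero_div, Finset.sum_const_zero, e1, e2, e3]
        linarith
    · obtain ⟨h1, h2⟩ := h.service t hpos
      have e1 : g t = 0 := by
        have : ξ t ≠ 0 := fun h => by simp [h] at hpos
        simp [hg, this, hpos.ne']
      have e2 := hg2 (t + 1)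
      have e3 : W (t + 1) = W t + (∑ i, lam i / mu i - 1) / mu (s t) + ∑ k, D t k / mu k := by
        have e4 : (∑ i, lam i / mu i - 1) / mu (s t) =
            ∑ k, (lam k / mu (s t) - if k = s t then 1 else 0) / mu k := by
          simp only [sub_div, Finset.sum_sub_distrib, ite_div, zero_div, Finset.sum_ite_eq',
            Finset.mem_univ, if_true, Finset.sum_div]
          congr 1
          exact Finset.sum_congr rfl fun k _ => div_right_comm _ _ _
        rw [e4]
        simp only [hW, h2, add_div, Finset.sum_add_distrib]
      have e4 := hδle (s t)
      rw [e1, e3]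
      nlinarith
  have hsum : ∀ t : ℕ, δ / 3 * t - 2 * δ / 3 + ∑ k, (∑ r ∈ Finset.range t, D r k) / mu k ≤
      W t - δ / 3 * g t := by
    intro t
    induction t with
    | zero =>
      have e1 := hW0 0
      have e2 := hg2 0
      simp only [Nat.cast_zero, mul_zero, Finset.range_zero, Finset.sum_empty, zero_div,
        Finset.sum_const_zero]
      nlinarith
    | succ t ih =>
      have e1 := hstep t
      simp only [Finset.sum_range_succ, add_div, Finset.sum_add_distrib]
      push_cast
      linarith
  set B := ∑ k, (mu k)⁻¹ with hB
  have hB0 : 0 < B := Finset.sum_pos (fun k _ => inv_pos.2 (hmu k)) Finset.univ_nonempty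
  have hWB : ∀ t, W t ≤ B * ∑ k, (ξ t k : ℝ) := fun t => by
    rw [Finset.mul_sum]
    refine Finset.sum_le_sum fun k _ => ?_
    rw [div_eq_inv_mul]
    exact mul_le_mul_of_nonneg_right
      (Finset.single_le_sum (f := fun k => (mu k)⁻¹) (fun k _ => (inv_pos.2 (hmu k)).le)
        (Finset.mem_univ k)) (Nat.cast_nonneg _)
  refine ⟨δ / (6 * B), by positivity, ?_⟩
  -- Of the rate `δ/3`, the noise costs at most `δ/12` and the initial term `2δ/3` at most `δ/12`
  -- once `t ≥ 8`; `δ/6` is left.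
  filter_upwards [h.eventually_abs_noise_le (ε := δ / (12 * B)) (by positivity),
    eventually_ge_atTop 8] with t ht ht8
  have ht8 : (8 : ℝ) ≤ t := by exact_mod_cast ht8
  have e1 : -(δ / 12 * t) ≤ ∑ k, (∑ r ∈ Finset.range t, D r k) / mu k := by
    have e2 : ∑ k, -(δ / (12 * B) * t) / mu k = -(δ / 12 * t) := by
      rw [show ∑ k, -(δ / (12 * B) * t) / mu k = -(δ / (12 * B) * t) * B by
        simp only [div_eq_mul_inv _ (mu _), ← Finset.mul_sum, ← hB]]
      field_simp
    rw [← e2]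
    exact Finset.sum_le_sum fun k _ => div_le_div_of_nonneg_right (abs_le.1 (ht k)).1 (hmu k).le
  have e2 := hsum t
  have e3 := hWB t
  have e4 := hg0 t
  rw [show δ / (6 * B) * t = (δ / 6 * t) / B by field_simp, div_le_iff₀ hB0]
  nlinarith [mul_nonneg hδ.le e4, mul_nonneg hδ.le (sub_nonneg.2 ht8)]

/-- A stretch of uninterrupted service at node `j`. -/
lemma service_run (h : IsDrivenPath lam mu d ξ s D) {a : ℕ} {j : Fin 3} (ha : s a = j) (k : ℕ)
    (hpos : ∀ r < k, 0 < ξ (a + r) (s (a + r))) : s (a + k) = j ∧ ∀ i, (ξ (a + k) i : ℝ) =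
      ξ a i + k * (lam i / mu j - if i = j then 1 else 0) +
      ((∑ r ∈ Finset.range (a + k), D r i) - ∑ r ∈ Finset.range a, D r i) := by
  induction k with
  | zero => simp [ha]
  | succ k ih =>
    obtain ⟨h1, h2⟩ := ih fun r hr => hpos r (by omega)
    obtain ⟨h3, h4⟩ := h.service (a + k) (hpos k (by omega))
    rw [h1] at h3 h4
    refine ⟨h3, fun i => ?_⟩
    rw [← add_assoc, h4, h2, Finset.sum_range_succ]
    push_cast
    ring

/-- With no further switches one node of a nonempty system would be served forever, and its negative
drift would make its queue negative. -/
lemma switchTimes_infinite (h : IsDrivenPath lam mu d ξ s D) (hmu : ∀ i, 0 < mu i)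
    (hlm : ∀ i, lam i < mu i) (hne : ∀ᶠ t in atTop, ξ t ≠ 0) :
    (switchTimes s).Infinite := by
  intro hfin
  obtain ⟨b, hb⟩ := hfin.bddAbove
  obtain ⟨T₀, hT₀⟩ := eventually_atTop.1 hne
  have hθ : ∀ j, 0 < 1 - lam j / mu j := fun j => sub_pos.2 ((div_lt_one (hmu j)).2 (hlm j))
  set T := max T₀ (b + 1) with hT
  have hpos : ∀ r, 0 < ξ (T + r) (s (T + r)) := by
    intro r
    by_contra h0
    have h0 : ξ (T + r) (s (T + r)) = 0 := by omega
    have h1 := h.switch _ h0 (hT₀ _ (by omega))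
    have := hb (show T + r ∈ switchTimes s from h1.2.1.ne)
    omega
  set j := s T with hj
  set θ := 1 - lam j / mu j with hθj
  have hθ0 : 0 < θ := hθ j
  obtain ⟨N, hN⟩ := eventually_atTop.1 (h.eventually_abs_noise_le (ε := θ / 2) (by positivity))
  -- Large enough for the drift `θ k` to beat the initial queue and the noise `(θ/2)(T + k)`; the
  -- summand `N` puts the time in the range of the noise bound.
  obtain ⟨k, hk⟩ := exists_nat_gt (2 / θ * (ξ T j + θ / 2 * T + |∑ r ∈ Finset.range T, D r j|) + N)
  have hk0 : (N : ℝ) ≤ k := by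
    have : 0 ≤ 2 / θ * (ξ T j + θ / 2 * T + |∑ r ∈ Finset.range T, D r j|) := by positivity
    linarith
  have hk0 : N ≤ k := by exact_mod_cast hk0
  obtain ⟨-, h2⟩ := h.service_run (a := T) (j := j) rfl k fun r _ => hpos r
  have h3 := h2 j
  rw [if_pos rfl] at h3
  have h4 := (abs_le.1 (hN (T + k) (by omega) j)).2
  have h5 := neg_abs_le (∑ r ∈ Finset.range T, D r j)
  have h6 : (0 : ℝ) ≤ ξ (T + k) j := Nat.cast_nonneg _
  have h7 : 2 / θ * (ξ T j + θ / 2 * T + |∑ r ∈ Finset.range T, D r j|) < k := by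
    have : (0 : ℝ) ≤ N := Nat.cast_nonneg _
    linarith
  rw [div_mul_eq_mul_div, div_lt_iff₀ hθ0] at h7
  push_cast at h4
  nlinarith

end IsDrivenPath

end Polling

/-! ### The path from one switch to the next, and its projection to the triangle -/

namespace Polling

variable {lam mu d : Fin 3 → ℝ} {ξ : ℕ → Fin 3 → ℕ} {s : ℕ → Fin 3} {D : ℕ → Fin 3 → ℝ}

namespace IsDrivenPath

/-- The path between two consecutive switches. -/
lemma between_switches (h : IsDrivenPath lam mu d ξ s D) (hinf : (switchTimes s).Infinite) {n : ℕ}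
    (hne : ∀ t ≥ switchTime s n, ξ t ≠ 0) :
    ξ (switchTime s n) (s (switchTime s n)) = 0 ∧
    Selects d (s (switchTime s n)) (fun i => (ξ (switchTime s n) i : ℝ))
      (s (switchTime s (n + 1))) ∧
    s (switchTime s n + 1) = s (switchTime s (n + 1)) ∧
    ∃ k : ℕ, switchTime s (n + 1) = switchTime s n + 1 + k ∧
      ∀ i, (ξ (switchTime s (n + 1)) i : ℝ) = ξ (switchTime s n) i +
        k * (lam i / mu (s (switchTime s (n + 1))) -
          if i = s (switchTime s (n + 1)) then 1 else 0) +
        ((∑ r ∈ Finset.range (switchTime s (n + 1)), D r i) -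
          ∑ r ∈ Finset.range (switchTime s n), D r i) := by
  have hmem : switchTime s n ∈ switchTimes s := Nat.nth_mem_of_infinite hinf n
  have hmono : StrictMono (switchTime s) := Nat.nth_strictMono hinf
  have hlt : switchTime s n < switchTime s (n + 1) := hmono n.lt_succ_self
  -- A switch strictly between would have a rank strictly between `n` and `n + 1`.
  have hgap : ∀ t, switchTime s n < t → t < switchTime s (n + 1) → t ∉ switchTimes s := by
    classical
    intro t h1 h2 ht
    have h3 : Nat.nth (· ∈ switchTimes s) (Nat.count (· ∈ switchTimes s) t) = t := Nat.nth_count ht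
    have h4 : switchTime s (Nat.count (· ∈ switchTimes s) t) = t := h3
    rw [← h4, hmono.lt_iff_lt] at h1 h2
    omega
  set τ := switchTime s n
  set τ' := switchTime s (n + 1)
  have h0 : ξ τ (s τ) = 0 := by
    by_contra hpos
    exact hmem (h.service τ (by omega)).1
  obtain ⟨hξ, hsel, hD⟩ := h.switch τ h0 (hne τ le_rfl)
  -- Epoch `τ` is the switch itself and leaves the queues unchanged, so the `k` services begin at `τ
  -- + 1`.
  obtain ⟨k, hk⟩ := Nat.exists_eq_add_of_le (Nat.succ_le_of_lt hlt)
  have hk : τ' = τ + 1 + k := hk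
  have hpos : ∀ r < k, 0 < ξ (τ + 1 + r) (s (τ + 1 + r)) := by
    intro r hr
    by_contra h1
    exact hgap (τ + 1 + r) (by omega) (by omega)
      (h.switch _ (by omega) (hne _ (by omega))).2.1.ne
  obtain ⟨h1, h2⟩ := h.service_run (a := τ + 1) rfl k hpos
  rw [← hk] at h1 h2
  refine ⟨h0, h1 ▸ hsel, h1.symm, k, hk, fun i => ?_⟩
  rw [h2, h1, hξ, Finset.sum_range_succ _ τ, hD, Pi.zero_apply, add_zero]

/-- Between two switches the path follows its fluid limit. -/
lemma eventually_abs_sub_le (h : IsDrivenPath lam mu d ξ s D) (hlam : ∀ i, 0 < lam i)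
    (hmu : ∀ i, 0 < mu i)
    (hlm : ∀ i, lam i < mu i) (hinf : (switchTimes s).Infinite) {c : ℝ} (hc : 0 < c)
    (hgrow : ∀ᶠ t : ℕ in atTop, c * t ≤ ∑ k, (ξ t k : ℝ)) {ε : ℝ} (hε : 0 < ε) :
    ∀ᶠ n in atTop, ∀ i ≠ s (switchTime s (n + 1)),
      |(ξ (switchTime s (n + 1)) i : ℝ) - (ξ (switchTime s n) i +
        lam i / (mu (s (switchTime s (n + 1))) - lam (s (switchTime s (n + 1)))) *
          ξ (switchTime s n) (s (switchTime s (n + 1))))| ≤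
      ε * ∑ k, (ξ (switchTime s n) k : ℝ) := by
  have hmono : StrictMono (switchTime s) := Nat.nth_strictMono hinf
  obtain ⟨θ, hθ, hθle⟩ := exists_pos_le (fun j => 1 - lam j / mu j)
    (fun j => sub_pos.2 ((div_lt_one (hmu j)).2 (hlm j)))
  obtain ⟨B, hB⟩ := (Set.finite_range
    (fun p : Fin 3 × Fin 3 => lam p.1 / (mu p.2 - lam p.2))).bddAbove
  have hB : ∀ i j, lam i / (mu j - lam j) ≤ B := fun i j => hB ⟨(i, j), rfl⟩
  have hB0 : 0 ≤ B := (div_nonneg (hlam 0).le (sub_pos.2 (hlm 0)).le).trans (hB 0 0)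
  -- Chosen so that `3τ + k ≤ K Y`, from `τ ≤ Y / c` and `k ≤ (2/θ)(1 + 3/c) Y`.
  set K := 3 / c + 2 / θ * (1 + 3 / c) with hK
  have hK0 : 0 < K := by positivity
  obtain ⟨η, hη0, hη1, hη2, hη3⟩ : ∃ η > 0, η ≤ 1 ∧ η ≤ θ / 2 ∧ (B + 1) * (η * K) ≤ ε := by
    refine ⟨min (min 1 (θ / 2)) (ε / ((B + 1) * K)), by positivity,
      (min_le_left _ _).trans (min_le_left _ _), (min_le_left _ _).trans (min_le_right _ _), ?_⟩
    have := min_le_right (min 1 (θ / 2)) (ε / ((B + 1) * K))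
    rw [le_div_iff₀ (by positivity)] at this
    linarith
  obtain ⟨T, hT⟩ := eventually_atTop.1 (hgrow.and (h.eventually_abs_noise_le hη0))
  filter_upwards [hmono.tendsto_atTop.eventually_ge_atTop (max T 1)] with n hn i hi
  have hne : ∀ t ≥ switchTime s n, ξ t ≠ 0 := by
    intro t ht h0
    have h1 := (hT t (by omega)).1
    simp only [h0, Pi.zero_apply, Nat.cast_zero, Finset.sum_const_zero] at h1
    have h2 : (0 : ℝ) < t := Nat.cast_pos.2 (by omega)
    have := mul_pos hc h2
    linarith
  have hlast : ξ (switchTime s (n + 1)) (s (switchTime s (n + 1))) = 0 :=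
    (h.between_switches hinf (n := n + 1)
      fun t ht => hne t ((hmono n.lt_succ_self).le.trans ht)).1
  obtain ⟨-, -, -, k, hk, hrun⟩ := h.between_switches hinf hne
  have hτ1 : (1 : ℝ) ≤ switchTime s n := by exact_mod_cast (by omega : 1 ≤ switchTime s n)
  have hYτ := (hT _ (by omega : T ≤ switchTime s n)).1
  have hM := (hT _ (by omega : T ≤ switchTime s n)).2
  have hM' := (hT _ (by omega : T ≤ switchTime s (n + 1))).2
  set τ := switchTime s n
  set τ' := switchTime s (n + 1)
  set j := s τ'
  set Y := ∑ k, (ξ τ k : ℝ)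
  have hyY : (ξ τ j : ℝ) ≤ Y :=
    Finset.single_le_sum (f := fun k => (ξ τ k : ℝ)) (fun _ _ => Nat.cast_nonneg _)
      (Finset.mem_univ j)
  have hY0 : 0 ≤ Y := Finset.sum_nonneg fun _ _ => Nat.cast_nonneg _
  have hτY : (τ : ℝ) ≤ Y / c := by rw [le_div_iff₀ hc]; linarith
  have hτ' : (τ' : ℝ) = τ + 1 + k := by rw [hk]; push_cast; ring
  have hk0 : (0 : ℝ) ≤ k := Nat.cast_nonneg _
  obtain ⟨e, he⟩ : ∃ e : Fin 3 → ℝ, ∀ i, e i =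
      (∑ r ∈ Finset.range τ', D r i) - ∑ r ∈ Finset.range τ, D r i := ⟨_, fun _ => rfl⟩
  have he1 : ∀ i, |e i| ≤ η * (3 * τ + k) := fun i => by
    rw [he]
    refine (abs_sub _ _).trans ((add_le_add (hM' i) (hM i)).trans ?_)
    rw [hτ', ← mul_add]
    exact mul_le_mul_of_nonneg_left (by linarith) hη0.le
  simp only [← he] at hrun
  have hθj : θ ≤ 1 - lam j / mu j := hθle j
  have hj := hrun j
  rw [if_pos rfl, hlast, Nat.cast_zero] at hj
  -- Node `j` is empty at `τ'`, so `(1 - λ_j/μ_j) k = ξ τ j + e j`; the part `η k` of the error is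
  -- absorbed by half of the drift.
  have hkY : (k : ℝ) ≤ 2 / θ * (1 + 3 / c) * Y := by
    have h1 := (abs_le.1 (he1 j)).2
    have h2 : θ * k ≤ (1 - lam j / mu j) * k := mul_le_mul_of_nonneg_right hθj hk0
    have h3 : η * k ≤ θ / 2 * k := mul_le_mul_of_nonneg_right hη2 hk0
    have h4 : η * (3 * τ) ≤ 1 * (3 * (Y / c)) :=
      mul_le_mul hη1 (by linarith) (by positivity) zero_le_one
    have h5 : θ / 2 * k ≤ (1 + 3 / c) * Y := by
      have : (1 + 3 / c) * Y = Y + 1 * (3 * (Y / c)) := by ring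
      rw [this]
      nlinarith
    have h6 : 2 / θ * (1 + 3 / c) * Y = (2 / θ) * ((1 + 3 / c) * Y) := by ring
    rw [h6]
    calc (k : ℝ) = 2 / θ * (θ / 2 * k) := by field_simp
      _ ≤ _ := mul_le_mul_of_nonneg_left h5 (by positivity)
  have he2 : ∀ i, |e i| ≤ η * K * Y := fun i => by
    refine (he1 i).trans ?_
    rw [mul_assoc]
    refine mul_le_mul_of_nonneg_left ?_ hη0.le
    have : K * Y = 3 * (Y / c) + 2 / θ * (1 + 3 / c) * Y := by rw [hK]; ring
    linarith
  have hlmj := sub_pos.2 (hlm j)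
  have hmuj := hmu j
  -- The same equation eliminates the random number `k` of services.
  have hkey : (k : ℝ) * (lam i / mu j) = lam i / (mu j - lam j) * (ξ τ j + e j) := by
    have : (ξ τ j : ℝ) + e j = k * (1 - lam j / mu j) := by linarith
    rw [this]
    field_simp
  rw [hrun i, if_neg hi, sub_zero, hkey]
  have hL0 : 0 ≤ lam i / (mu j - lam j) := div_nonneg (hlam i).le hlmj.le
  calc |(ξ τ i : ℝ) + lam i / (mu j - lam j) * (ξ τ j + e j) + e i -
        (ξ τ i + lam i / (mu j - lam j) * ξ τ j)| = |lam i / (mu j - lam j) * e j + e i| := by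
        congr 1; ring
    _ ≤ lam i / (mu j - lam j) * |e j| + |e i| := by
        refine (abs_add_le _ _).trans ?_
        rw [abs_mul, abs_of_nonneg hL0]
    _ ≤ B * (η * K * Y) + η * K * Y :=
        add_le_add (mul_le_mul (hB i j) (he2 j) (abs_nonneg _) hB0) (he2 i)
    _ = (B + 1) * (η * K) * Y := by ring
    _ ≤ ε * Y := mul_le_mul_of_nonneg_right hη3 hY0

end IsDrivenPath

/-- `nodeMap` is the projection of the fluid endpoint `p`, whose mass off `j` is at least `q` times
the initial mass. Normalization thus magnifies the relative error only by a constant. -/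
lemma abs_proj_sub_nodeMap_le {j : Fin 3} {y y' : Fin 3 → ℝ} (hlam : ∀ i, 0 < lam i)
    (hlm : ∀ i, lam i < mu i) (hy : ∀ i, 0 ≤ y i) (hy' : y' j = 0) (hpos : 0 < ∑ k, y k)
    {q ε : ℝ} (hq : 0 < q) (hq1 : q ≤ 1) (hq2 : q ≤ (lam (j + 1) + lam (j + 2)) / (mu j - lam j))
    (hε : 0 < ε) (hεq : ε ≤ q / 4)
    (herr : ∀ i ≠ j, |y' i - (y i + lam i / (mu j - lam j) * y j)| ≤ ε * ∑ k, y k) (k : Fin 3) :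
    |proj y' k - nodeMap lam mu j (proj y) k| ≤ 6 * ε / q := by
  by_cases hk : k = j
  · rw [hk, nodeMap_self, proj, hy', zero_div, sub_zero, abs_zero]
    positivity
  set T := ∑ k, y k with hT
  have ha := sub_pos.2 (hlm j)
  set p : Fin 3 → ℝ := fun i => y i + lam i / (mu j - lam j) * y j with hp
  have hp0 : ∀ i, 0 ≤ p i := fun i =>
    add_nonneg (hy i) (mul_nonneg (div_nonneg (hlam i).le ha.le) (hy j))
  have hTj : T = y j + y (j + 1) + y (j + 2) := sum_cyclic y j
  have hT' : ∑ k, y' k = y' (j + 1) + y' (j + 2) := by rw [sum_cyclic y' j, hy', zero_add]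
  have e1 := herr _ (add_one_ne j)
  have e2 := herr _ (add_two_ne j)
  have hPq : q * T ≤ p (j + 1) + p (j + 2) := by
    have h1 := mul_le_mul_of_nonneg_right hq2 (hy j)
    have h2 := mul_le_mul_of_nonneg_right hq1 (hy (j + 1))
    have h3 := mul_le_mul_of_nonneg_right hq1 (hy (j + 2))
    simp only [hp, hTj]
    rw [add_div, add_mul] at h1
    linarith
  have hP0 : 0 < p (j + 1) + p (j + 2) := (mul_pos hq hpos).trans_le hPq
  have hdiff : |∑ k, y' k - (p (j + 1) + p (j + 2))| ≤ 2 * ε * T := by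
    rw [hT', add_sub_add_comm]
    refine (abs_add_le _ _).trans ?_
    simp only [hp]
    linarith
  have hT'q : q / 2 * T ≤ ∑ k, y' k := by
    have h1 := (abs_le.1 hdiff).1
    have h2 : ε * T ≤ q / 4 * T := mul_le_mul_of_nonneg_right hεq hpos.le
    linarith
  have hT'0 : 0 < ∑ k, y' k := (mul_pos (half_pos hq) hpos).trans_le hT'q
  have hnode : nodeMap lam mu j (proj y) k = p k / (p (j + 1) + p (j + 2)) := by
    have hD : (mu j - lam j) + ((∑ k, lam k) - mu j) * proj y j =
        (mu j - lam j) * (p (j + 1) + p (j + 2)) / T := by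
      simp only [proj, ← hT, hp, sum_cyclic lam j]
      field_simp
      rw [hTj]
      ring
    rw [nodeMap_of_ne hk, hD, div_eq_div_iff (by positivity) hP0.ne']
    simp only [proj, ← hT, hp]
    field_simp
  have hle : p k / (p (j + 1) + p (j + 2)) ≤ 1 := by
    rw [div_le_one hP0]
    have h1 := hp0 (j + 1)
    have h2 := hp0 (j + 2)
    rcases eq_cyclic j k with rfl | rfl | rfl
    · exact absurd rfl hk
    · linarith
    · linarith
  set x := p k / (p (j + 1) + p (j + 2)) with hx
  have hx0 : 0 ≤ x := div_nonneg (hp0 k) hP0.le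
  have hpx : p k = x * (p (j + 1) + p (j + 2)) := by rw [hx]; field_simp
  -- As `0 ≤ x ≤ 1`, the numerator is at most `(ε + 2ε) T`, while the denominator is at least `q T /
  -- 2`; hence `6 ε / q`.
  have hfin : proj y' k - x =
      ((y' k - p k) - x * (∑ k, y' k - (p (j + 1) + p (j + 2)))) / ∑ k, y' k := by
    rw [mul_sub, ← hpx, proj]
    field_simp
    ring
  rw [hnode, hfin, abs_div, abs_of_pos hT'0, div_le_div_iff₀ hT'0 hq]
  have h1 : |(y' k - p k) - x * (∑ k, y' k - (p (j + 1) + p (j + 2)))| ≤ 3 * ε * T := by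
    refine (abs_sub _ _).trans ?_
    rw [abs_mul, abs_of_nonneg hx0]
    have h2 := herr k hk
    have h3 := mul_le_mul hle hdiff (abs_nonneg _) zero_le_one
    simp only [hp] at h2 h3 ⊢
    linarith
  have h2 := mul_le_mul_of_nonneg_right h1 hq.le
  have h3 := mul_le_mul_of_nonneg_left hT'q (by positivity : (0 : ℝ) ≤ 6 * ε)
  linarith

/-- The theorem for a single sample path whose noise averages out. -/
theorem IsDrivenPath.converges (h : IsDrivenPath lam mu d ξ s D)
    (hlam : ∀ i, 0 < lam i) (hmu : ∀ i, 0 < mu i)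
    (hlm : ∀ i, lam i < mu i) (hload : 1 < ∑ i, lam i / mu i) (hd : ∀ i, d i ∈ Set.Ioo (0 : ℝ) 1)
    (hstable : IsStable lam mu d) (havoid : OrbitsAvoidDecisionPoints lam mu d) :
    (switchTimes s).Infinite ∧
      (∃ m u, IsPeriodicOrbit lam mu d m u ∧ ConvergesOnto (zeta ξ s) m u) ∧
      EventuallyPeriodic (visitedNode s) := by
  obtain ⟨c, hc, hgrow⟩ := h.exists_linear_growth hmu hload hd
  have hne : ∀ᶠ t in atTop, ξ t ≠ 0 := by
    filter_upwards [hgrow, eventually_gt_atTop 0] with t ht ht0 h0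
    simp only [h0, Pi.zero_apply, Nat.cast_zero, Finset.sum_const_zero] at ht
    have := mul_pos hc (Nat.cast_pos.2 ht0)
    linarith
  have hinf := h.switchTimes_infinite hmu hlm hne
  have hmono : StrictMono (switchTime s) := Nat.nth_strictMono hinf
  refine ⟨hinf, ?_⟩
  obtain ⟨T, hT⟩ := eventually_atTop.1 hne
  -- The first `N` switches are discarded, so that the system is never empty afterwards.
  obtain ⟨N, hN⟩ := eventually_atTop.1 (hmono.tendsto_atTop.eventually_ge_atTop T)
  have hne' : ∀ n, ∀ t ≥ switchTime s (n + N), ξ t ≠ 0 := fun n t ht =>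
    hT t ((hN (n + N) (by omega)).trans ht)
  have hbtw := fun n => h.between_switches hinf (hne' n)
  have hsum : ∀ n, 0 < ∑ k, (ξ (switchTime s (n + N)) k : ℝ) := fun n => by
    have h1 := hne' n _ le_rfl
    rw [← Nat.cast_sum, Nat.cast_pos, Nat.pos_iff_ne_zero]
    intro h2
    exact h1 (funext fun k => (Finset.sum_eq_zero_iff.1 h2) k (Finset.mem_univ k))
  obtain ⟨q, hq, hqle⟩ := exists_pos_le
    (fun j => min 1 ((lam (j + 1) + lam (j + 2)) / (mu j - lam j)))
    (fun j => lt_min one_pos (div_pos (add_pos (hlam _) (hlam _)) (sub_pos.2 (hlm j))))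
  obtain ⟨m, u, hu, ⟨n₀, hconv⟩, N', hN'⟩ := exists_convergesOnto_of_pseudoTrajectory hlam hlm hd
    hstable havoid (z := fun n => zeta ξ s (n + N)) (i := fun n => s (switchTime s (n + N)))
    (fun n => ⟨fun k => div_nonneg (Nat.cast_nonneg _) (hsum n).le, by
        simp only [zeta, proj, ← Finset.sum_div]
        exact div_self (hsum n).ne', by simp [zeta, proj, (hbtw n).1]⟩)
    (fun n => by
      -- The threshold rule is homogeneous, so it passes to the normalized queues.
      have h1 := (hbtw n).2.1.smul (inv_nonneg.2 (hsum n).le)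
      have h2 : zeta ξ s (n + N) = (∑ k, (ξ (switchTime s (n + N)) k : ℝ))⁻¹ •
          fun i => (ξ (switchTime s (n + N)) i : ℝ) := by
        funext k
        simp only [zeta, proj, Pi.smul_apply, smul_eq_mul, div_eq_inv_mul]
      rw [h2, add_right_comm]
      exact h1) (by
      rw [Metric.tendsto_atTop]
      intro ε hε
      obtain ⟨η, hη, hη1, hη2⟩ : ∃ η > 0, η ≤ q / 4 ∧ 6 * η / q < ε := by
        refine ⟨min (q / 4) (q * ε / 12), by positivity, min_le_left _ _, ?_⟩
        rw [div_lt_iff₀ hq]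
        have := min_le_right (q / 4) (q * ε / 12)
        have := mul_pos hq hε
        linarith
      obtain ⟨R, hR⟩ := eventually_atTop.1
        (h.eventually_abs_sub_le hlam hmu hlm hinf hc hgrow hη)
      refine ⟨R, fun n hn => ?_⟩
      rw [dist_zero_right]
      refine lt_of_le_of_lt ((pi_norm_le_iff_of_nonneg (by positivity)).2 fun k => ?_) hη2
      have h1 := hR (n + N) (by omega)
      have h2 := (hbtw (n + 1)).1
      rw [add_right_comm n 1 N] at h2 ⊢
      exact abs_proj_sub_nodeMap_le hlam hlm (y := fun i => (ξ (switchTime s (n + N)) i : ℝ))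
        (y' := fun i => (ξ (switchTime s (n + N + 1)) i : ℝ)) (fun i => Nat.cast_nonneg _)
        (by simp only [h2, Nat.cast_zero]) (hsum n) hq ((hqle 0).trans (min_le_left _ _))
        ((hqle _).trans (min_le_right _ _)) hη hη1 h1 k)
  refine ⟨⟨m, u, hu, n₀ + N, fun n hn => (hconv n hn).congr fun t => by simp only [add_assoc]⟩,
    m, hu.1, N' + N, fun n hn => ?_⟩
  obtain ⟨r, rfl⟩ : ∃ r, n = r + N := ⟨n - N, by omega⟩
  -- The node entered at `τ_n` is the one emptied at `τ_{n+1}`, so visited nodes are the sides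
  -- shifted by one.
  have h1 := (hbtw r).2.2.1
  have h2 := (hbtw (r + m)).2.2.1
  have h3 := hN' (r + 1) (by omega)
  simp only [visitedNode]
  rw [h1, show r + N + m = r + m + N by omega, h2, show r + m + N + 1 = r + 1 + m + N by omega, h3,
    show r + N + 1 = r + 1 + N by omega]

end Polling

namespace Polling

/-! ### The strong law of large numbers for orthogonal sequences -/

variable {Ω : Type*} {mΩ : MeasurableSpace Ω} {P : Measure Ω}

/-- By Tonelli the series of the `f k` has finite expectation, so it converges almost surely and its
terms vanish. -/
lemma ae_tendsto_zero_of_summable {f : ℕ → Ω → ℝ} {b : ℕ → ℝ} (hf : ∀ k, Integrable (f k) P)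
    (hf0 : ∀ k ω, 0 ≤ f k ω) (hb : ∀ k, ∫ ω, f k ω ∂P ≤ b k) (hsum : Summable b) :
    ∀ᵐ ω ∂P, Tendsto (fun k => f k ω) atTop (𝓝 0) := by
  have hmeas : ∀ k, AEMeasurable (fun ω => ENNReal.ofReal (f k ω)) P := fun k =>
    (hf k).aestronglyMeasurable.aemeasurable.ennreal_ofReal
  have hfin : ∫⁻ ω, ∑' k, ENNReal.ofReal (f k ω) ∂P ≠ ⊤ := by
    rw [lintegral_tsum hmeas]
    refine ne_top_of_le_ne_top hsum.tsum_ofReal_ne_top (ENNReal.tsum_le_tsum fun k => ?_)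
    rw [← ofReal_integral_eq_lintegral_ofReal (hf k) (Eventually.of_forall (hf0 k))]
    exact ENNReal.ofReal_le_ofReal (hb k)
  filter_upwards [ae_lt_top' (AEMeasurable.tsum hmeas) hfin] with ω hω
  have h1 := ENNReal.tendsto_atTop_zero_of_tsum_ne_top hω.ne
  have h2 := (ENNReal.tendsto_toReal ENNReal.zero_ne_top).comp h1
  simpa [Function.comp_def, ENNReal.toReal_ofReal (hf0 _ ω)] using h2

/-- Pythagoras: the cross terms vanish. -/
lemma integral_sq_sum_le {X : ℕ → Ω → ℝ} (hX : ∀ n, MemLp (X n) 2 P)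
    (horth : ∀ m n, m < n → ∫ ω, X m ω * X n ω ∂P = 0) {C : ℝ}
    (hC : ∀ n, ∫ ω, X n ω ^ 2 ∂P ≤ C) (t : ℕ) :
    ∫ ω, (∑ r ∈ Finset.range t, X r ω) ^ 2 ∂P ≤ C * t := by
  have hS : ∀ t, MemLp (fun ω => ∑ r ∈ Finset.range t, X r ω) 2 P := fun t =>
    memLp_finsetSum _ fun r _ => hX r
  have hXX : ∀ r t, Integrable (fun ω => X r ω * X t ω) P := fun r t => (hX r).integrable_mul (hX t)
  have hSX : ∀ t, Integrable (fun ω => (∑ r ∈ Finset.range t, X r ω) * X t ω) P := fun t =>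
    (hS t).integrable_mul (hX t)
  induction t with
  | zero => simp
  | succ t ih =>
    have h0 : ∫ ω, (∑ r ∈ Finset.range t, X r ω) * X t ω ∂P = 0 := by
      simp only [Finset.sum_mul]
      rw [integral_finsetSum _ fun r _ => hXX r t]
      exact Finset.sum_eq_zero fun r hr => horth r t (Finset.mem_range.1 hr)
    have h1 : ∫ ω, (∑ r ∈ Finset.range (t + 1), X r ω) ^ 2 ∂P =
        ∫ ω, (∑ r ∈ Finset.range t, X r ω) ^ 2 ∂P +
          2 * ∫ ω, (∑ r ∈ Finset.range t, X r ω) * X t ω ∂P + ∫ ω, X t ω ^ 2 ∂P := by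
      have h2 : (fun ω => (∑ r ∈ Finset.range (t + 1), X r ω) ^ 2) = fun ω =>
          (∑ r ∈ Finset.range t, X r ω) ^ 2 + 2 * ((∑ r ∈ Finset.range t, X r ω) * X t ω) +
            X t ω ^ 2 := by
        funext ω
        rw [Finset.sum_range_succ]
        ring
      have h3 : Integrable (fun ω => (∑ r ∈ Finset.range t, X r ω) ^ 2 +
          2 * ((∑ r ∈ Finset.range t, X r ω) * X t ω)) P :=
        (hS t).integrable_sq.add ((hSX t).const_mul 2)
      rw [h2, integral_add h3 (hX t).integrable_sq,
        integral_add (hS t).integrable_sq ((hSX t).const_mul 2), integral_const_mul]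
    rw [h1, h0]
    have := hC t
    push_cast
    linarith

/-- **Rajchman's strong law**: the averages of an orthogonal sequence with bounded second moments
tend to zero almost surely. -/
theorem ae_tendsto_average_of_orthogonal {X : ℕ → Ω → ℝ} (hX : ∀ n, MemLp (X n) 2 P)
    (horth : ∀ m n, m < n → ∫ ω, X m ω * X n ω ∂P = 0) {C : ℝ}
    (hC : ∀ n, ∫ ω, X n ω ^ 2 ∂P ≤ C) :
    ∀ᵐ ω ∂P, Tendsto (fun t : ℕ => (∑ r ∈ Finset.range t, X r ω) / t) atTop (𝓝 0) := by
  have hC0 : 0 ≤ C := (integral_nonneg fun ω => sq_nonneg (X 0 ω)).trans (hC 0)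
  set S : ℕ → Ω → ℝ := fun t ω => ∑ r ∈ Finset.range t, X r ω with hS
  -- Blocks between consecutive squares: partial sums at squares are handled by orthogonality, the
  -- increments within a block by Cauchy–Schwarz.
  set I : ℕ → Finset ℕ := fun k => Finset.Ico ((k + 1) ^ 2) ((k + 2) ^ 2) with hI
  set f : ℕ → Ω → ℝ := fun k ω =>
    (S ((k + 1) ^ 2) ω ^ 2 + (∑ r ∈ I k, |X r ω|) ^ 2) / ((k : ℝ) + 1) ^ 4 with hf
  have hSi : ∀ t, Integrable (fun ω => S t ω ^ 2) P := fun t =>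
    (memLp_finsetSum _ fun r _ => hX r : MemLp (S t) 2 P).integrable_sq
  have hGi : ∀ k, Integrable (fun ω => (∑ r ∈ I k, |X r ω|) ^ 2) P := fun k =>
    (memLp_finsetSum _ fun r _ => (hX r).abs :
      MemLp (fun ω => ∑ r ∈ I k, |X r ω|) 2 P).integrable_sq
  have hcard : ∀ k, ((I k).card : ℝ) = 2 * k + 3 := fun k => by
    rw [hI, Nat.card_Ico, show (k + 2) ^ 2 - (k + 1) ^ 2 = 2 * k + 3 by
      rw [show (k + 2) ^ 2 = (k + 1) ^ 2 + (2 * k + 3) by ring, Nat.add_sub_cancel_left]]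
    push_cast
    ring
  have hG : ∀ k, ∫ ω, (∑ r ∈ I k, |X r ω|) ^ 2 ∂P ≤ C * (2 * k + 3) ^ 2 := fun k => by
    calc ∫ ω, (∑ r ∈ I k, |X r ω|) ^ 2 ∂P
        ≤ ∫ ω, (2 * k + 3) * ∑ r ∈ I k, X r ω ^ 2 ∂P := by
          refine integral_mono (hGi k) ((integrable_finsetSum _ fun r _ =>
            (hX r).integrable_sq).const_mul _) fun ω => ?_
          have := sq_sum_le_card_mul_sum_sq (s := I k) (f := fun r => |X r ω|)
          simpa only [hcard, sq_abs] using this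
      _ = (2 * k + 3) * ∑ r ∈ I k, ∫ ω, X r ω ^ 2 ∂P := by
          rw [integral_const_mul, integral_finsetSum _ fun r _ => (hX r).integrable_sq]
      _ ≤ (2 * k + 3) * ∑ r ∈ I k, C :=
          mul_le_mul_of_nonneg_left (Finset.sum_le_sum fun r _ => hC r) (by positivity)
      _ = C * (2 * k + 3) ^ 2 := by
          rw [Finset.sum_const, nsmul_eq_mul, hcard]
          ring
  -- The constant is `10 = 1 + 9`, from the sum at the square and `2k + 3 ≤ 3(k + 1)`.
  have hlim := ae_tendsto_zero_of_summable (P := P) (f := f)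
    (b := fun k => 10 * C * (1 / ((k + 1 : ℕ) : ℝ) ^ 2))
    (fun k => ((hSi _).add (hGi k)).div_const _) (fun k ω => by positivity) (fun k => by
      have hk : (0 : ℝ) < (k : ℝ) + 1 := by positivity
      have h1 := integral_sq_sum_le hX horth hC ((k + 1) ^ 2)
      have h2 : (2 * k + 3 : ℝ) ^ 2 ≤ 9 * (k + 1) ^ 2 := by nlinarith [Nat.cast_nonneg (α := ℝ) k]
      have h3 := mul_le_mul_of_nonneg_left h2 hC0
      have h4 := hG k
      simp only [hf]
      rw [integral_div, integral_add (hSi _) (hGi k), div_le_iff₀ (by positivity)]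
      have h5 : 10 * C * (1 / ((k + 1 : ℕ) : ℝ) ^ 2) * ((k : ℝ) + 1) ^ 4 =
          10 * C * ((k : ℝ) + 1) ^ 2 := by
        push_cast
        field_simp
      rw [h5]
      push_cast at h1
      linarith)
    (((summable_nat_add_iff 1).2 (Real.summable_one_div_nat_pow.2 one_lt_two)).mul_left _)
  filter_upwards [hlim] with ω hω
  have hsqrt : Tendsto (fun t : ℕ => Nat.sqrt t - 1) atTop atTop := by
    refine tendsto_atTop.2 fun b => ?_
    filter_upwards [eventually_ge_atTop ((b + 1) ^ 2)] with t ht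
    have : b + 1 ≤ Nat.sqrt t := Nat.le_sqrt'.2 ht
    omega
  -- For `k = ⌊√t⌋ - 1` one has `(k + 1)² ≤ t < (k + 2)²`, so block `k` controls `S t`.
  have hbound : ∀ᶠ t : ℕ in atTop, (S t ω / t) ^ 2 ≤ 2 * f (Nat.sqrt t - 1) ω := by
    filter_upwards [eventually_ge_atTop 1] with t ht
    have h1 : 1 ≤ Nat.sqrt t := Nat.le_sqrt'.2 (by simpa using ht)
    obtain ⟨k, hk⟩ : ∃ k, Nat.sqrt t = k + 1 := ⟨Nat.sqrt t - 1, by omega⟩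
    have h2 : (k + 1) ^ 2 ≤ t := hk ▸ Nat.sqrt_le' t
    have h3 : t < (k + 2) ^ 2 := by
      have := Nat.lt_succ_sqrt' t
      rwa [hk] at this
    rw [hk, Nat.add_sub_cancel]
    have h4 : S t ω = S ((k + 1) ^ 2) ω + ∑ r ∈ Finset.Ico ((k + 1) ^ 2) t, X r ω :=
      (Finset.sum_range_add_sum_Ico _ h2).symm
    have h5 : |∑ r ∈ Finset.Ico ((k + 1) ^ 2) t, X r ω| ≤ ∑ r ∈ I k, |X r ω| :=
      (Finset.abs_sum_le_sum_abs _ _).trans (Finset.sum_le_sum_of_subset_of_nonneg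
        (Finset.Ico_subset_Ico_right h3.le) fun _ _ _ => abs_nonneg _)
    have h6 : (S t ω) ^ 2 ≤ 2 * (S ((k + 1) ^ 2) ω ^ 2 + (∑ r ∈ I k, |X r ω|) ^ 2) := by
      have h7 := sq_le_sq' (by linarith [abs_nonneg (∑ r ∈ Finset.Ico ((k + 1) ^ 2) t, X r ω)]) h5
      rw [sq_abs] at h7
      rw [h4]
      nlinarith [sq_nonneg (S ((k + 1) ^ 2) ω - ∑ r ∈ Finset.Ico ((k + 1) ^ 2) t, X r ω)]
    have h8 : ((k : ℝ) + 1) ^ 4 ≤ (t : ℝ) ^ 2 := by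
      have : ((k : ℝ) + 1) ^ 2 ≤ t := by exact_mod_cast h2
      calc ((k : ℝ) + 1) ^ 4 = (((k : ℝ) + 1) ^ 2) ^ 2 := by ring
        _ ≤ _ := pow_le_pow_left₀ (by positivity) this 2
    simp only [hf]
    rw [div_pow, ← mul_div_assoc]
    exact div_le_div₀ (by positivity) h6 (by positivity) h8
  have h1 : Tendsto (fun t : ℕ => (S t ω / t) ^ 2) atTop (𝓝 0) := by
    have h2 := (hω.comp hsqrt).const_mul 2
    rw [mul_zero] at h2
    exact squeeze_zero' (Eventually.of_forall fun t => sq_nonneg _) hbound h2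
  have h2 := h1.sqrt
  simp only [Real.sqrt_sq_eq_abs, Real.sqrt_zero] at h2
  exact (tendsto_zero_iff_abs_tendsto_zero _).2 h2

end Polling

namespace Polling

/-! ### The law of the arrivals during a service -/

open ProbabilityTheory ENNReal NNReal

lemma lintegral_poissonMeasure (r : ℝ≥0) (f : ℕ → ℝ≥0∞) :
    ∫⁻ n, f n ∂(poissonMeasure r) = ∑' n : ℕ, f n * ENNReal.ofReal (Real.exp (-r) * r ^ n / n.factorial) := by
  rw [lintegral_countable']
  simp only [poissonMeasure_singleton]

/-- The Stein–Chen identity for the Poisson distribution. -/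
lemma lintegral_mul_poissonMeasure (r : ℝ≥0) (f : ℕ → ℝ≥0∞) :
    ∫⁻ n, n * f n ∂(poissonMeasure r) = r * ∫⁻ n, f (n + 1) ∂(poissonMeasure r) := by
  rw [lintegral_poissonMeasure, lintegral_poissonMeasure,
    tsum_eq_zero_add' (ENNReal.summable), ← ENNReal.tsum_mul_left]
  simp only [Nat.cast_zero, zero_mul, zero_add]
  refine tsum_congr fun n => ?_
  have h : ((n + 1 : ℕ) : ℝ≥0∞) * ENNReal.ofReal (Real.exp (-r) * r ^ (n + 1) / (n + 1).factorial) =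
      r * ENNReal.ofReal (Real.exp (-r) * r ^ n / n.factorial) := by
    rw [← ENNReal.ofReal_natCast, ← ENNReal.ofReal_mul (by positivity), ← ENNReal.ofReal_coe_nnreal,
      ← ENNReal.ofReal_mul (by positivity), Nat.factorial_succ]
    congr 1
    push_cast
    field_simp
    ring
  rw [mul_right_comm, h]
  ring

lemma lintegral_id_poissonMeasure (r : ℝ≥0) : ∫⁻ n, (n : ℝ≥0∞) ∂(poissonMeasure r) = r := by
  simpa using lintegral_mul_poissonMeasure r fun _ => 1

lemma lintegral_sq_poissonMeasure (r : ℝ≥0) :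
    ∫⁻ n, (n : ℝ≥0∞) ^ 2 ∂(poissonMeasure r) = r * (r + 1) := by
  have h := lintegral_mul_poissonMeasure r fun n => n
  simp only [← sq, Nat.cast_add, Nat.cast_one] at h
  rw [h, lintegral_add_right _ measurable_const, lintegral_id_poissonMeasure]
  simp

variable {lam : Fin 3 → ℝ} {S : Measure ℝ} [IsProbabilityMeasure S]

/-- The integrand is a product of Poisson probabilities, hence bounded by `1` and integrable, so the
Bochner integral is not a default value. -/
lemma ofReal_arrivalProb (hlam : ∀ i, 0 < lam i) (hS : ∀ᵐ x ∂S, 0 ≤ x) (n : Fin 3 → ℕ) :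
    ENNReal.ofReal (arrivalProb lam S n) =
      ∫⁻ s, ENNReal.ofReal (∏ i, Real.exp (-(lam i * s)) * (lam i * s) ^ n i / (n i).factorial) ∂S := by
  have h0 : ∀ᵐ s ∂S, 0 ≤ ∏ i, Real.exp (-(lam i * s)) * (lam i * s) ^ n i / (n i).factorial := by
    filter_upwards [hS] with s hs
    exact Finset.prod_nonneg fun i _ => by
      have := mul_nonneg (hlam i).le hs
      positivity
  refine ofReal_integral_eq_lintegral_ofReal ?_ h0
  refine Integrable.of_bound (C := 1) (Continuous.aestronglyMeasurable (by fun_prop)) ?_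
  filter_upwards [hS, h0] with s hs hs0
  rw [Real.norm_of_nonneg hs0]
  refine Finset.prod_le_one (fun i _ => ?_) fun i _ => ?_
  · have := mul_nonneg (hlam i).le hs
    positivity
  · have h1 := mul_nonneg (hlam i).le hs
    have h2 := Real.pow_div_factorial_le_exp _ h1 (n i)
    rw [mul_div_assoc]
    calc Real.exp (-(lam i * s)) * ((lam i * s) ^ n i / (n i).factorial)
        ≤ Real.exp (-(lam i * s)) * Real.exp (lam i * s) :=
          mul_le_mul_of_nonneg_left h2 (Real.exp_nonneg _)
      _ = 1 := by rw [← Real.exp_add, neg_add_cancel, Real.exp_zero]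

/-- The number of arrivals at a given node is a mixture of Poisson variables. -/
lemma tsum_arrivalProb (hlam : ∀ i, 0 < lam i) (hS : ∀ᵐ x ∂S, 0 ≤ x) (i : Fin 3) (f : ℕ → ℝ≥0∞) :
    ∑' n : Fin 3 → ℕ, f (n i) * ENNReal.ofReal (arrivalProb lam S n) =
      ∫⁻ s, ∫⁻ m, f m ∂(poissonMeasure (lam i * s).toNNReal) ∂S := by
  have hmeas : ∀ n : Fin 3 → ℕ, Measurable fun s : ℝ => ENNReal.ofReal
      (∏ i, Real.exp (-(lam i * s)) * (lam i * s) ^ n i / (n i).factorial) := fun n =>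
    (Continuous.measurable (by fun_prop)).ennreal_ofReal
  simp only [ofReal_arrivalProb hlam hS]
  simp only [← lintegral_const_mul _ (hmeas _)]
  rw [← lintegral_tsum fun n => ((hmeas n).const_mul _).aemeasurable]
  refine lintegral_congr_ae ?_
  filter_upwards [hS] with s hs
  -- For fixed `s` the product is the mass of `{n}` under a product of Poisson laws, and only its
  -- `i`-th marginal matters.
  rw [← (measurePreserving_eval (fun i => poissonMeasure (lam i * s).toNNReal) i).lintegral_comp
    (Measurable.of_discrete), lintegral_countable']
  refine tsum_congr fun n => ?_
  rw [Measure.pi_singleton, ENNReal.ofReal_prod_of_nonneg]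
  · congr 1
    refine Finset.prod_congr rfl fun k _ => ?_
    rw [poissonMeasure_singleton, Real.coe_toNNReal _ (mul_nonneg (hlam k).le hs)]
  · intro k _
    have := mul_nonneg (hlam k).le hs
    positivity

lemma tsum_arrivalProb_eq_one (hlam : ∀ i, 0 < lam i) (hS : ∀ᵐ x ∂S, 0 ≤ x) :
    ∑' n : Fin 3 → ℕ, ENNReal.ofReal (arrivalProb lam S n) = 1 := by
  simpa using tsum_arrivalProb hlam hS 0 fun _ => 1

lemma tsum_mul_arrivalProb (hlam : ∀ i, 0 < lam i) (hS : ∀ᵐ x ∂S, 0 ≤ x)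
    (hint : Integrable (fun x : ℝ => x) S) (i : Fin 3) :
    ∑' n : Fin 3 → ℕ, (n i : ℝ≥0∞) * ENNReal.ofReal (arrivalProb lam S n) =
      ENNReal.ofReal (lam i * ∫ x, x ∂S) := by
  rw [tsum_arrivalProb hlam hS i fun m => (m : ℝ≥0∞), ← integral_const_mul,
    ofReal_integral_eq_lintegral_ofReal (hint.const_mul _)
      (hS.mono fun x hx => mul_nonneg (hlam i).le hx)]
  simp only [lintegral_id_poissonMeasure]
  rfl

lemma tsum_sq_mul_arrivalProb_ne_top (hlam : ∀ i, 0 < lam i) (hS : ∀ᵐ x ∂S, 0 ≤ x)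
    (hL2 : MemLp (fun x : ℝ => x) 2 S) (i : Fin 3) :
    ∑' n : Fin 3 → ℕ, (n i : ℝ≥0∞) ^ 2 * ENNReal.ofReal (arrivalProb lam S n) ≠ ∞ := by
  have hint : Integrable (fun x : ℝ => (lam i * x) * (lam i * x + 1)) S := by
    have h1 := (hL2.integrable_sq.const_mul (lam i ^ 2)).add
      ((hL2.integrable one_le_two).const_mul (lam i))
    refine h1.congr (Eventually.of_forall fun x => ?_)
    simp only [Pi.add_apply]
    ring
  rw [tsum_arrivalProb hlam hS i fun m => (m : ℝ≥0∞) ^ 2]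
  refine ne_top_of_le_ne_top hint.lintegral_lt_top.ne (le_of_eq (lintegral_congr_ae ?_))
  filter_upwards [hS] with s hs
  have h := mul_nonneg (hlam i).le hs
  rw [lintegral_sq_poissonMeasure, ENNReal.ofReal_mul h, ENNReal.ofReal_add h zero_le_one,
    ENNReal.ofReal_one]
  rfl

end Polling

namespace Polling

/-! ### The noise of the polling system -/

/-- Disjoint events whose conditional probabilities sum to one exhaust `E` up to a null set. This
turns the conditional laws into almost sure transition rules. -/
lemma HasCondProb.ae_exists {Ω ι : Type*} [Countable ι] {𝓕 mΩ : MeasurableSpace Ω} {P : Measure Ω}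
    [IsProbabilityMeasure P] (h𝓕 : 𝓕 ≤ mΩ)
    {E : Set Ω} (hE : MeasurableSet[𝓕] E) {B : ι → Set Ω} (hB : ∀ n, MeasurableSet (B n))
    (hdisj : Pairwise (Function.onFun Disjoint B)) {p : ι → ℝ}
    (h : ∀ n, HasCondProb P 𝓕 E (B n) (p n)) (hp : ∑' n, ENNReal.ofReal (p n) = 1) :
    ∀ᵐ ω ∂P, ω ∈ E → ∃ n, ω ∈ B n := by
  have hU : P (E ∩ ⋃ n, B n) = P E := by
    rw [Set.inter_iUnion, measure_iUnion
      (fun i j hij => (hdisj hij).mono Set.inter_subset_right Set.inter_subset_right)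
      fun n => (h𝓕 _ hE).inter (hB n)]
    simp only [fun n => h n E hE subset_rfl, ENNReal.tsum_mul_right, hp, one_mul]
  have h0 : P (E \ ⋃ n, B n) = 0 := by
    have h1 := measure_inter_add_sdiff (μ := P) E (MeasurableSet.iUnion hB)
    rw [hU] at h1
    exact (ENNReal.add_right_inj (measure_ne_top P E)).1 (by rw [h1, add_zero])
  rw [ae_iff]
  refine measure_mono_null (fun ω hω => ?_) h0
  simp only [Set.mem_ofPred_eq, Classical.not_imp, not_exists] at hω
  exact ⟨hω.1, by simpa using hω.2⟩

/-- The arrivals during a step from `x` to `x'` in which a job of node `j` is served. -/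
def arrivals (x x' : Fin 3 → ℕ) (j : Fin 3) : Fin 3 → ℕ :=
  fun i => x' i + (if i = j then 1 else 0) - x i

/-- The deviation of the number of arrivals at node `i` from its mean, in a step from `x` to `x'`
with the server at `j`; it is zero unless a job is served. -/
noncomputable def noise (lam mu : Fin 3 → ℝ) (x : Fin 3 → ℕ) (j : Fin 3) (x' : Fin 3 → ℕ)
    (i : Fin 3) : ℝ :=
  if 0 < x j then (arrivals x x' j i : ℝ) - lam i / mu j else 0

namespace IsPollingProcess

variable {Ω : Type*} {mΩ : MeasurableSpace Ω} {P : Measure Ω} {ℱ : Filtration ℕ mΩ} {lam mu d : Fin 3 → ℝ} {S : Fin 3 → Measure ℝ}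
  {ξ : ℕ → Ω → Fin 3 → ℕ} {s : ℕ → Ω → Fin 3}

lemma measurableSet_serving (h : IsPollingProcess P ℱ lam S d ξ s) (t : ℕ) (j : Fin 3) :
    MeasurableSet[ℱ t] {ω | s t ω = j ∧ 0 < ξ t ω j} :=
  ((h.adapted_server t).prodMk (h.adapted_queue t))
    (MeasurableSet.of_discrete (s := {p : Fin 3 × (Fin 3 → ℕ) | p.1 = j ∧ 0 < p.2 j}))

lemma measurable_queue (h : IsPollingProcess P ℱ lam S d ξ s) (t : ℕ) : Measurable (ξ t) :=
  (h.adapted_queue t).mono (ℱ.le t) le_rfl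

lemma measurable_server (h : IsPollingProcess P ℱ lam S d ξ s) (t : ℕ) : Measurable (s t) :=
  (h.adapted_server t).mono (ℱ.le t) le_rfl

lemma measurable_arrivals (h : IsPollingProcess P ℱ lam S d ξ s) (t : ℕ) (j : Fin 3) :
    Measurable fun ω => arrivals (ξ t ω) (ξ (t + 1) ω) j :=
  (Measurable.of_discrete (f := fun p : (Fin 3 → ℕ) × (Fin 3 → ℕ) => arrivals p.1 p.2 j)).comp
    ((h.measurable_queue t).prodMk (h.measurable_queue (t + 1)))

lemma measurable_noise (h : IsPollingProcess P ℱ lam S d ξ s) (t : ℕ) (i : Fin 3) :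
    Measurable[ℱ (t + 1)] fun ω => noise lam mu (ξ t ω) (s t ω) (ξ (t + 1) ω) i := by
  have hle : ℱ t ≤ ℱ (t + 1) := ℱ.mono t.le_succ
  exact (Measurable.of_discrete (f := fun p : ((Fin 3 → ℕ) × Fin 3) × (Fin 3 → ℕ) =>
    noise lam mu p.1.1 p.1.2 p.2 i)).comp ((((h.adapted_queue t).mono hle le_rfl).prodMk
      ((h.adapted_server t).mono hle le_rfl)).prodMk (h.adapted_queue (t + 1)))

lemma measurableSet_served (h : IsPollingProcess P ℱ lam S d ξ s) (t : ℕ) (j : Fin 3)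
    (n : Fin 3 → ℕ) : MeasurableSet {ω | s (t + 1) ω = j ∧
      ∀ i, ξ (t + 1) ω i + (if i = j then 1 else 0) = ξ t ω i + n i} :=
  ((h.measurable_server (t + 1)).prodMk ((h.measurable_queue t).prodMk
    (h.measurable_queue (t + 1)))) (MeasurableSet.of_discrete
      (s := {p : Fin 3 × ((Fin 3 → ℕ) × (Fin 3 → ℕ)) | p.1 = j ∧
        ∀ i, p.2.2 i + (if i = j then 1 else 0) = p.2.1 i + n i}))

/-- The truncated subtraction in `arrivals` loses nothing on the service events. -/
lemma arrivals_eq {t : ℕ} {j : Fin 3} {n : Fin 3 → ℕ} {ω : Ω}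
    (hω : ∀ i, ξ (t + 1) ω i + (if i = j then 1 else 0) = ξ t ω i + n i) :
    arrivals (ξ t ω) (ξ (t + 1) ω) j = n := by
  funext i
  rw [arrivals, hω, Nat.add_sub_cancel_left]

/-- Splitting by the node in service gives events on which the conditional law is a fixed one. -/
lemma noise_eq_sum (t : ℕ) (i : Fin 3) (ω : Ω) :
    noise lam mu (ξ t ω) (s t ω) (ξ (t + 1) ω) i = ∑ j, {ω | s t ω = j ∧ 0 < ξ t ω j}.indicator
      (fun ω => (arrivals (ξ t ω) (ξ (t + 1) ω) j i : ℝ) - lam i / mu j) ω := by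
  rw [Finset.sum_eq_single (s t ω)]
  · by_cases hpos : 0 < ξ t ω (s t ω)
    · have hmem : ω ∈ {ω' | s t ω' = s t ω ∧ 0 < ξ t ω' (s t ω)} := ⟨rfl, hpos⟩
      rw [noise, if_pos hpos, Set.indicator_of_mem hmem]
    · rw [noise, if_neg hpos, Set.indicator_of_notMem fun h => hpos h.2]
  · intro j _ hj
    exact Set.indicator_of_notMem (fun h => hj h.1.symm) _
  · simp

variable [IsProbabilityMeasure P]

lemma ae_served (h : IsPollingProcess P ℱ lam S d ξ s) (hlam : ∀ i, 0 < lam i)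
    (hSprob : ∀ i, IsProbabilityMeasure (S i)) (hS : ∀ i, ∀ᵐ x ∂(S i), 0 ≤ x) (t : ℕ) (j : Fin 3) :
    ∀ᵐ ω ∂P, (s t ω = j ∧ 0 < ξ t ω j) → s (t + 1) ω = j ∧
      ∀ i, ξ (t + 1) ω i + (if i = j then 1 else 0) =
        ξ t ω i + arrivals (ξ t ω) (ξ (t + 1) ω) j i := by
  have := hSprob j
  filter_upwards [HasCondProb.ae_exists (ℱ.le t) (h.measurableSet_serving t j)
    (h.measurableSet_served t j) (fun n n' hn => Set.disjoint_left.2 fun ω hω hω' =>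
      hn ((arrivals_eq hω.2).symm.trans (arrivals_eq hω'.2))) (h.service t j)
    (tsum_arrivalProb_eq_one hlam (hS j))] with ω hω hω'
  obtain ⟨n, hn⟩ := hω hω'
  rw [arrivals_eq hn.2]
  exact hn

/-- The conditional law of the arrivals during a service. -/
lemma setLIntegral_arrivals (h : IsPollingProcess P ℱ lam S d ξ s) (hlam : ∀ i, 0 < lam i)
    (hSprob : ∀ i, IsProbabilityMeasure (S i)) (hS : ∀ i, ∀ᵐ x ∂(S i), 0 ≤ x) (t : ℕ) (j : Fin 3)
    {A : Set Ω} (hA : MeasurableSet[ℱ t] A) (hAE : A ⊆ {ω | s t ω = j ∧ 0 < ξ t ω j})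
    (f : (Fin 3 → ℕ) → ENNReal) :
    ∫⁻ ω in A, f (arrivals (ξ t ω) (ξ (t + 1) ω) j) ∂P =
      (∑' n, f n * ENNReal.ofReal (arrivalProb lam (S j) n)) * P A := by
  have hN := h.measurable_arrivals t j
  rw [← lintegral_map (Measurable.of_discrete) hN, lintegral_countable', ← ENNReal.tsum_mul_right]
  refine tsum_congr fun n => ?_
  rw [mul_assoc, ← h.service t j n A hA hAE, Measure.map_apply hN (MeasurableSet.singleton n),
    Measure.restrict_apply (hN (MeasurableSet.singleton n)), Set.inter_comm]
  congr 1
  refine measure_congr ?_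
  filter_upwards [h.ae_served hlam hSprob hS t j] with ω hω
  refine propext (and_congr_right fun hωA => ⟨fun hn => ?_, fun hn => arrivals_eq hn.2⟩)
  have h1 := hω (hAE hωA)
  have hn : arrivals (ξ t ω) (ξ (t + 1) ω) j = n := hn
  rw [hn] at h1
  exact h1

/-- The noise of the services at node `j` is centred and has bounded second moments. -/
lemma exists_noise_at_node (h : IsPollingProcess P ℱ lam S d ξ s) (hlam : ∀ i, 0 < lam i)
    (hmu : ∀ i, 0 < mu i) (hSprob : ∀ i, IsProbabilityMeasure (S i))
    (hS : ∀ i, ∀ᵐ x ∂(S i), 0 ≤ x) (hSvar : ∀ i, MemLp (fun x : ℝ => x) 2 (S i))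
    (hSmean : ∀ i, ∫ x, x ∂(S i) = (mu i)⁻¹) (i j : Fin 3) :
    ∃ C : ℝ, ∀ t, ∀ Y : Ω → ℝ, Y = {ω | s t ω = j ∧ 0 < ξ t ω j}.indicator
        (fun ω => (arrivals (ξ t ω) (ξ (t + 1) ω) j i : ℝ) - lam i / mu j) →
      MemLp Y 2 P ∧ ∫ ω, Y ω ^ 2 ∂P ≤ C ∧ ∀ A, MeasurableSet[ℱ t] A → ∫ ω in A, Y ω ∂P = 0 := by
  have := hSprob j
  set c := lam i / mu j with hc
  have hc0 : 0 < c := div_pos (hlam i) (hmu j)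
  obtain ⟨q, hq, hqtop⟩ : ∃ q, ∑' n : Fin 3 → ℕ, (n i : ENNReal) ^ 2 *
      ENNReal.ofReal (arrivalProb lam (S j) n) = q ∧ q ≠ ⊤ :=
    ⟨_, rfl, tsum_sq_mul_arrivalProb_ne_top hlam (hS j) (hSvar j) i⟩
  have hmean := tsum_mul_arrivalProb hlam (hS j) ((hSvar j).integrable one_le_two) i
  rw [hSmean j, ← div_eq_mul_inv, ← hc] at hmean
  -- From `(V - c)² ≤ 2V² + 2c²`, where `q` is the second moment of the arrivals.
  refine ⟨2 * q.toReal + 2 * c ^ 2, fun t Y hY => ?_⟩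
  set E := {ω | s t ω = j ∧ 0 < ξ t ω j} with hE
  have hEm : MeasurableSet[ℱ t] E := h.measurableSet_serving t j
  have hEm' : MeasurableSet E := ℱ.le t _ hEm
  set N : Ω → ℕ := fun ω => arrivals (ξ t ω) (ξ (t + 1) ω) j i with hN
  have hNm : Measurable N := (measurable_pi_apply i).comp (h.measurable_arrivals t j)
  have hNr : Measurable fun ω => (N ω : ℝ) := Measurable.of_discrete.comp hNm
  set V : Ω → ℝ := E.indicator fun ω => (N ω : ℝ) with hV
  have hVm : Measurable V := hNr.indicator hEm'
  have hVsq : ∫⁻ ω, ENNReal.ofReal (V ω ^ 2) ∂P = q * P E := by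
    have h1 : (fun ω => ENNReal.ofReal (V ω ^ 2)) = E.indicator fun ω => (N ω : ENNReal) ^ 2 := by
      funext ω
      by_cases hω : ω ∈ E
      · simp only [hV, Set.indicator_of_mem hω]
        rw [ENNReal.ofReal_pow (Nat.cast_nonneg _), ENNReal.ofReal_natCast]
      · simp [hV, Set.indicator_of_notMem hω]
    rw [h1, lintegral_indicator hEm', ← hq]
    exact h.setLIntegral_arrivals hlam hSprob hS t j hEm subset_rfl fun n => (n i : ENNReal) ^ 2
  have hqE : q * P E ≤ q := mul_le_of_le_one_right' prob_le_one
  have hV2 : MemLp V 2 P := by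
    refine (memLp_two_iff_integrable_sq hVm.aestronglyMeasurable).2
      ⟨(hVm.pow_const 2).aestronglyMeasurable, ?_⟩
    rw [hasFiniteIntegral_iff_ofReal (Eventually.of_forall fun ω => sq_nonneg _), hVsq]
    exact hqE.trans_lt hqtop.lt_top
  have hVint : ∫ ω, V ω ^ 2 ∂P ≤ q.toReal := by
    rw [integral_eq_lintegral_of_nonneg_ae (Eventually.of_forall fun ω => sq_nonneg _)
      (hVm.pow_const 2).aestronglyMeasurable, hVsq]
    exact ENNReal.toReal_mono hqtop hqE
  have hYV : Y = fun ω => V ω - E.indicator (fun _ => c) ω := by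
    rw [hY, hV]
    exact Set.indicator_sub E _ _
  have hY2 : MemLp Y 2 P := by
    rw [hYV]
    exact hV2.sub ((memLp_const c).indicator hEm')
  refine ⟨hY2, ?_, fun A hA => ?_⟩
  · calc ∫ ω, Y ω ^ 2 ∂P ≤ ∫ ω, (2 * V ω ^ 2 + 2 * c ^ 2) ∂P := by
          refine integral_mono hY2.integrable_sq
            ((hV2.integrable_sq.const_mul 2).add (integrable_const _)) fun ω => ?_
          rw [hYV]
          by_cases hω : ω ∈ E
          · simp only [Set.indicator_of_mem hω]
            nlinarith [sq_nonneg (V ω + c)]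
          · simp only [Set.indicator_of_notMem hω]
            nlinarith [sq_nonneg (V ω), sq_nonneg c]
      _ = 2 * ∫ ω, V ω ^ 2 ∂P + 2 * c ^ 2 := by
          rw [integral_add (hV2.integrable_sq.const_mul 2) (integrable_const _),
            integral_const_mul, integral_const]
          simp
      _ ≤ _ := by linarith
  · have hAE : MeasurableSet[ℱ t] (A ∩ E) := hA.inter hEm
    have hNint : IntegrableOn (fun ω => (N ω : ℝ)) (A ∩ E) P :=
      ((integrable_indicator_iff hEm').1 (hV2.integrable one_le_two)).mono_set
        Set.inter_subset_right
    have h1 := h.setLIntegral_arrivals hlam hSprob hS t j hAE Set.inter_subset_right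
      fun n => (n i : ENNReal)
    rw [hmean] at h1
    have h2 : ∫ ω in A ∩ E, (N ω : ℝ) ∂P = c * P.real (A ∩ E) := by
      rw [integral_eq_lintegral_of_nonneg_ae (Eventually.of_forall fun ω => Nat.cast_nonneg _)
        hNr.aestronglyMeasurable]
      simp only [ENNReal.ofReal_natCast, hN, h1]
      rw [ENNReal.toReal_mul, ENNReal.toReal_ofReal hc0.le]
      rfl
    rw [hY, setIntegral_indicator hEm', integral_sub hNint (integrable_const _), h2,
      setIntegral_const, smul_eq_mul, mul_comm, sub_self]

/-- The averages of the noise tend to zero. -/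
lemma ae_tendsto_average_noise (h : IsPollingProcess P ℱ lam S d ξ s) (hlam : ∀ i, 0 < lam i)
    (hmu : ∀ i, 0 < mu i) (hSprob : ∀ i, IsProbabilityMeasure (S i))
    (hS : ∀ i, ∀ᵐ x ∂(S i), 0 ≤ x) (hSvar : ∀ i, MemLp (fun x : ℝ => x) 2 (S i))
    (hSmean : ∀ i, ∫ x, x ∂(S i) = (mu i)⁻¹) (i : Fin 3) :
    ∀ᵐ ω ∂P, Tendsto (fun t : ℕ => (∑ r ∈ Finset.range t,
      noise lam mu (ξ r ω) (s r ω) (ξ (r + 1) ω) i) / t) atTop (𝓝 0) := by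
  choose C hC using h.exists_noise_at_node hlam hmu hSprob hS hSvar hSmean i
  set X : ℕ → Ω → ℝ := fun t ω => noise lam mu (ξ t ω) (s t ω) (ξ (t + 1) ω) i with hX
  set Y : ℕ → Fin 3 → Ω → ℝ := fun t j => {ω | s t ω = j ∧ 0 < ξ t ω j}.indicator
      (fun ω => (arrivals (ξ t ω) (ξ (t + 1) ω) j i : ℝ) - lam i / mu j) with hY
  have hXY : ∀ t, X t = fun ω => ∑ j, Y t j ω := fun t => funext fun ω => noise_eq_sum t i ω
  have hYL : ∀ t j, MemLp (Y t j) 2 P := fun t j => (hC j t _ rfl).1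
  have hXL : ∀ t, MemLp (X t) 2 P := fun t => by
    rw [hXY]
    exact memLp_finsetSum _ fun j _ => hYL t j
  have hXm : ∀ t, StronglyMeasurable[ℱ (t + 1)] (X t) := fun t =>
    (h.measurable_noise t i).stronglyMeasurable
  have hX0 : ∀ t, (0 : Ω → ℝ) =ᵐ[P] P[X t | ℱ t] := fun t => by
    refine ae_eq_condExp_of_forall_setIntegral_eq (ℱ.le t) ((hXL t).integrable one_le_two)
      (fun A _ _ => integrableOn_zero) (fun A hA _ => ?_)
      stronglyMeasurable_zero.aestronglyMeasurable
    simp only [Pi.zero_apply, integral_zero, hXY]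
    rw [integral_finsetSum _ fun j _ => ((hYL t j).integrable one_le_two).integrableOn]
    exact (Finset.sum_eq_zero fun j _ => (hC j t _ rfl).2.2 A hA).symm
  -- Orthogonality comes from conditioning on `ℱ n`, which makes `X m` known and `X n` centred; the
  -- factor `3` is Cauchy–Schwarz over the three nodes.
  refine ae_tendsto_average_of_orthogonal (C := 3 * ∑ j, C j) hXL (fun m n hmn => ?_) fun t => ?_
  · have h1 : P[X m * X n | ℱ n] =ᵐ[P] X m * P[X n | ℱ n] :=
      condExp_mul_of_stronglyMeasurable_left ((hXm m).mono (ℱ.mono hmn))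
        ((hXL m).integrable_mul (hXL n)) ((hXL n).integrable one_le_two)
    calc ∫ ω, X m ω * X n ω ∂P = ∫ ω, (P[X m * X n | ℱ n]) ω ∂P := (integral_condExp (ℱ.le n)).symm
      _ = ∫ ω, (0 : ℝ) ∂P := by
        refine integral_congr_ae ?_
        filter_upwards [h1, hX0 n] with ω h2 h3
        rw [h2, Pi.mul_apply, ← h3, Pi.zero_apply, mul_zero]
      _ = 0 := integral_zero _ _
  · calc ∫ ω, X t ω ^ 2 ∂P ≤ ∫ ω, 3 * ∑ j, Y t j ω ^ 2 ∂P := by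
          refine integral_mono (hXL t).integrable_sq ((integrable_finsetSum _ fun j _ =>
            (hYL t j).integrable_sq).const_mul 3) fun ω => ?_
          have := sq_sum_le_card_mul_sum_sq (s := Finset.univ) (f := fun j => Y t j ω)
          simpa [hXY] using this
      _ = 3 * ∑ j, ∫ ω, Y t j ω ^ 2 ∂P := by
          rw [integral_const_mul, integral_finsetSum _ fun j _ => (hYL t j).integrable_sq]
      _ ≤ 3 * ∑ j, C j := mul_le_mul_of_nonneg_left
          (Finset.sum_le_sum fun j _ => (hC j t _ rfl).2.1) (by norm_num)

lemma ae_idle (h : IsPollingProcess P ℱ lam S d ξ s) (hlam : ∀ i, 0 < lam i) (t : ℕ) (j : Fin 3) :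
    ∀ᵐ ω ∂P, (s t ω = j ∧ ξ t ω = 0) → s (t + 1) ω = j ∧ ξ (t + 1) ω ≠ 0 := by
  have hE : MeasurableSet[ℱ t] {ω | s t ω = j ∧ ξ t ω = 0} :=
    ((h.adapted_server t).prodMk (h.adapted_queue t))
      (MeasurableSet.of_discrete (s := {p : Fin 3 × (Fin 3 → ℕ) | p.1 = j ∧ p.2 = 0}))
  have hB : ∀ k : Fin 3, MeasurableSet {ω | s (t + 1) ω = j ∧ ξ (t + 1) ω = Pi.single k 1} :=
    fun k => ((h.measurable_server (t + 1)).prodMk (h.measurable_queue (t + 1)))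
      (MeasurableSet.of_discrete
        (s := {p : Fin 3 × (Fin 3 → ℕ) | p.1 = j ∧ p.2 = Pi.single k 1}))
  have hne : ∀ k : Fin 3, (Pi.single k 1 : Fin 3 → ℕ) ≠ 0 := fun k h0 => by
    have := congrFun h0 k
    simp at this
  have hpos : 0 < ∑ i, lam i := Finset.sum_pos (fun i _ => hlam i) Finset.univ_nonempty
  filter_upwards [HasCondProb.ae_exists (ℱ.le t) hE hB (fun k k' hk =>
    Set.disjoint_left.2 fun ω hω hω' => by
      have h1 := congrFun (hω.2.symm.trans hω'.2) k
      simp [hk] at h1) (h.idle t j) (by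
      rw [tsum_fintype, ← ENNReal.ofReal_sum_of_nonneg
        fun k _ => div_nonneg (hlam k).le hpos.le, ← Finset.sum_div, div_self hpos.ne',
        ENNReal.ofReal_one])] with ω hω hω'
  obtain ⟨k, h1, h2⟩ := hω hω'
  exact ⟨h1, h2 ▸ hne k⟩

/-- Almost every sample path of the polling system is driven by a noise that averages out. -/
lemma ae_isDrivenPath (h : IsPollingProcess P ℱ lam S d ξ s) (hlam : ∀ i, 0 < lam i)
    (hmu : ∀ i, 0 < mu i) (hSprob : ∀ i, IsProbabilityMeasure (S i))
    (hS : ∀ i, ∀ᵐ x ∂(S i), 0 ≤ x) (hSvar : ∀ i, MemLp (fun x : ℝ => x) 2 (S i))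
    (hSmean : ∀ i, ∫ x, x ∂(S i) = (mu i)⁻¹) :
    ∀ᵐ ω ∂P, IsDrivenPath lam mu d (fun t => ξ t ω) (fun t => s t ω)
      fun t => noise lam mu (ξ t ω) (s t ω) (ξ (t + 1) ω) := by
  filter_upwards [ae_all_iff.2 fun t => ae_all_iff.2 fun j => h.ae_served hlam hSprob hS t j,
    ae_all_iff.2 h.switch, ae_all_iff.2 fun t => ae_all_iff.2 fun j => h.ae_idle hlam t j,
    ae_all_iff.2 fun i => h.ae_tendsto_average_noise hlam hmu hSprob hS hSvar hSmean i]
    with ω hserved hswitch hidle hnoise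
  refine ⟨fun t hpos => ?_, fun t h0 hne => ?_, fun t h0 => ?_, hnoise⟩
  · obtain ⟨h1, h2⟩ := hserved t _ ⟨rfl, hpos⟩
    refine ⟨h1, fun k => ?_⟩
    have h3 : (ξ (t + 1) ω k : ℝ) + (if k = s t ω then 1 else 0) =
        ξ t ω k + arrivals (ξ t ω) (ξ (t + 1) ω) (s t ω) k := by exact_mod_cast h2 k
    rw [noise, if_pos hpos]
    linarith
  · obtain ⟨h1, h2⟩ := hswitch t h0 hne
    refine ⟨h1, h2, funext fun i => ?_⟩
    rw [noise, if_neg (by omega)]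
    rfl
  · obtain ⟨h1, h2⟩ := hidle t _ ⟨rfl, h0⟩
    refine ⟨h1, h2, funext fun i => ?_⟩
    simp [noise, h0]

end IsPollingProcess

end Polling

/-! ### The pathwise theorem applied on an almost sure event -/

theorem theorem3p4
    (lam mu d : Fin 3 → ℝ) (S : Fin 3 → MeasureTheory.Measure ℝ)
    (hlam : ∀ i, 0 < lam i) (hmu : ∀ i, 0 < mu i)
    (hrho : ∀ i, lam i / mu i < 1) (hload : 1 < ∑ i, lam i / mu i)
    (hSprob : ∀ i, MeasureTheory.IsProbabilityMeasure (S i))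
    (hSnonneg : ∀ i, ∀ᵐ x ∂(S i), 0 ≤ x)
    (hSvar : ∀ i, MeasureTheory.MemLp (fun x : ℝ => x) 2 (S i))
    (hSmean : ∀ i, ∫ x, x ∂(S i) = (mu i)⁻¹)
    (hd : ∀ i, d i ∈ Set.Ioo (0 : ℝ) 1)
    (hstable : Polling.IsStable lam mu d)
    (havoid : Polling.OrbitsAvoidDecisionPoints lam mu d)
    {Ω : Type*} [mΩ : MeasurableSpace Ω] (P : MeasureTheory.Measure Ω)
    [MeasureTheory.IsProbabilityMeasure P] (ℱ : MeasureTheory.Filtration ℕ mΩ)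
    (ξ : ℕ → Ω → Fin 3 → ℕ) (s : ℕ → Ω → Fin 3)
    (hproc : Polling.IsPollingProcess P ℱ lam S d ξ s) :
    ∀ᵐ ω ∂P,
      (Polling.switchTimes (fun t => s t ω)).Infinite ∧
      (∃ m u, Polling.IsPeriodicOrbit lam mu d m u ∧
        Polling.ConvergesOnto (Polling.zeta (fun t => ξ t ω) (fun t => s t ω)) m u) ∧
      Polling.EventuallyPeriodic (Polling.visitedNode (fun t => s t ω)) := by
  have hlm : ∀ i, lam i < mu i := fun i => (div_lt_one (hmu i)).1 (hrho i)
  filter_upwards [hproc.ae_isDrivenPath hlam hmu hSprob hSnonneg hSvar hSmean] with ω hω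
  exact hω.converges hlam hmu hlm hload hd hstable havoid
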